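/- Let $k$ be a field of arbitrary characteristic. Let $\mathcal A$ be a finite set of linear hyperplanes in $\mathbb R^d$, and for each $H\in\mathcal A$ fix a labelling $H^+,H^-$ of its two open half-spaces; put $H^0=H$. A face of $\mathcal A$ is a nonempty set of the form $x=\bigcap_{H\in\mathcal A}H^{\sigma_H(x)}$ with $\sigma_H(x)\in\{+,-,0\}$. The set $\mathcal F$ of faces is partially ordered by $x\le y$ iff for every $H$ either $\sigma_H(x)=0$ or $\sigma_H(x)=\sigma_H(y)$ (the face poset), and is a monoid under the product with $\sigma_H(xy)=\sigma_H(x)$ if $\sigma_H(x)\ne0$ and $\sigma_H(xy)=\sigma_H(y)$ otherwise. The face semigroup algebra $k\mathcal F$ is the semigroup algebra of $\mathcal F$ over $k$. The support of a face $x$ is $\operatorname{supp}(x)=\bigcap_{\sigma_H(x)=0}H$, and the intersection lattice $\mathcal L$ is the set of all supports of faces, ordered by inclusion. **Corollary.** Let $\mathcal A$ and $\mathcal A'$ be finite central hyperplane arrangements in $\mathbb R^d$ and $\mathbb R^{d'}$ respectively, with face posets $\mathcal F,\mathcal F'$ and intersection lattices $\mathcal L,\mathcal L'$. If $\mathcal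 L$ and $\mathcal L'$ are isomorphic as partially ordered sets, then $k\mathcal F\cong k\mathcal F'$ as $k$-algebras. In particular, if $\mathcal L\cong\mathcal L'$ but the posets $\mathcal F$ and $\mathcal F'$ are not isomorphic, then still $k\mathcal F\cong k\mathcal F'$ as $k$-algebras. -/

import Mathlib

open scoped Topology

/-- A finite central hyperplane arrangement in `ℝ^d`: a finite set of linear hyperplanes, together
with the (arbitrary but fixed) choice, for every hyperplane `H`, of which of its two open
half-spaces is the positive one. The choice is recorded by a linear form with kernel `H`. -/
structure CentralArrangement (d : ℕ) where
  hyperplanes : Finset (Submodule ℝ (Fin d → ℝ))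
  isHyperplane : ∀ H ∈ hyperplanes, Module.finrank ℝ H + 1 = d
  form : hyperplanes → Module.Dual ℝ (Fin d → ℝ)
  ker_form : ∀ H : hyperplanes, LinearMap.ker (form H) = H.1

namespace CentralArrangement

variable {d : ℕ} (A : CentralArrangement d)

/-- The set `H^s`: the open half-space `H^+` or `H^-` for `s = 1`, `s = -1`, and `H` itself
for `s = 0`. -/
def halfSpace (H : A.hyperplanes) (s : SignType) : Set (Fin d → ℝ) :=
  {v | SignType.sign (A.form H v) = s}

theorem halfSpace_zero (H : A.hyperplanes) : A.halfSpace H 0 = (H.1 : Set (Fin d → ℝ)) := by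
  ext v
  rw [← A.ker_form H]
  simp [halfSpace]

/-- The intersection of the sets `H^(σ_H)` over all hyperplanes `H` of the arrangement. -/
def region (σ : A.hyperplanes → SignType) : Set (Fin d → ℝ) :=
  ⋂ H, A.halfSpace H (σ H)

theorem mem_region {σ : A.hyperplanes → SignType} {v : Fin d → ℝ} :
    v ∈ A.region σ ↔ ∀ H, SignType.sign (A.form H v) = σ H := by
  simp [region, halfSpace]

/-- A face of the arrangement is a nonempty region; it is encoded by its sign sequence, which it
determines (see `Face.toSet_injective`). -/
@[ext]
structure Face where
  sign : A.hyperplanes → SignType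
  nonempty : (A.region sign).Nonempty

namespace Face

variable {A}

/-- The face as a subset of `ℝ^d`. -/
def toSet (x : A.Face) : Set (Fin d → ℝ) := A.region x.sign

theorem toSet_injective : Function.Injective (toSet : A.Face → Set (Fin d → ℝ)) := by
  intro x y h
  obtain ⟨v, hv⟩ := x.nonempty
  have hv' : v ∈ A.region y.sign := by
    change v ∈ y.toSet
    rw [← h]
    exact hv
  rw [mem_region] at hv hv'
  ext1
  funext H
  rw [← hv H, hv' H]

/-- The face order: `x ≤ y` when, for every `H`, `σ_H(x) = 0` or `σ_H(x) = σ_H(y)`. -/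
instance : PartialOrder A.Face where
  le x y := ∀ H, x.sign H = 0 ∨ x.sign H = y.sign H
  le_refl _ _ := Or.inr rfl
  le_trans x y z hxy hyz H := by
    rcases hxy H with h | h
    · exact Or.inl h
    · rw [h]; exact hyz H
  le_antisymm x y hxy hyx := by
    ext1
    funext H
    rcases hxy H with h | h
    · rcases hyx H with h' | h'
      · rw [h, h']
      · exact h'.symm
    · exact h

/-- The face product: `σ_H(xy) = σ_H(x)` if `σ_H(x) ≠ 0`, and `σ_H(xy) = σ_H(y)` otherwise. -/
instance : Mul A.Face where
  mul x y :=
    { sign := fun H => if x.sign H ≠ 0 then x.sign H else y.sign H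
      nonempty := by
        obtain ⟨v, hv⟩ := x.nonempty
        obtain ⟨w, hw⟩ := y.nonempty
        rw [mem_region] at hv hw
        have key : ∀ H : A.hyperplanes, ∀ᶠ t : ℝ in 𝓝[>] 0,
            SignType.sign (A.form H (v + t • w)) =
              if x.sign H ≠ 0 then x.sign H else y.sign H := by
          intro H
          have hlim : Filter.Tendsto (fun t : ℝ => A.form H v + t * A.form H w) (𝓝[>] 0)
              (𝓝 (A.form H v)) := by
            have hc : Continuous (fun t : ℝ => A.form H v + t * A.form H w) := by fun_prop
            have := (hc.tendsto 0).mono_left (nhdsWithin_le_nhds (s := Set.Ioi (0 : ℝ)))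
            simpa using this
          rw [← hv H, ← hw H]
          simp only [map_add, map_smul, smul_eq_mul]
          rcases lt_trichotomy (A.form H v) 0 with h | h | h
          · filter_upwards [hlim.eventually (gt_mem_nhds h)] with t ht
            simp [sign_neg ht, sign_neg h]
          · filter_upwards [self_mem_nhdsWithin] with t ht
            simp [h, sign_mul, sign_pos (Set.mem_Ioi.1 ht)]
          · filter_upwards [hlim.eventually (lt_mem_nhds h)] with t ht
            simp [sign_pos ht, sign_pos h]
        obtain ⟨t, ht⟩ := (Filter.eventually_all.2 key).exists
        exact ⟨v + t • w, (A.mem_region).2 ht⟩ }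

/-- The identity element: the intersection of all the hyperplanes. -/
instance : One A.Face where
  one :=
    { sign := fun _ => 0
      nonempty := ⟨0, (A.mem_region).2 (by simp)⟩ }

theorem sign_mul (x y : A.Face) (H : A.hyperplanes) :
    (x * y).sign H = if x.sign H ≠ 0 then x.sign H else y.sign H := rfl

theorem sign_one (H : A.hyperplanes) : (1 : A.Face).sign H = 0 := rfl

/-- The face semigroup, a monoid. -/
instance : Monoid A.Face where
  mul_assoc x y z := by
    ext1
    funext H
    by_cases h : x.sign H = 0 <;> simp [sign_mul, h]
  one_mul x := by
    ext1
    funext H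
    simp [sign_mul, sign_one]
  mul_one x := by
    ext1
    funext H
    by_cases h : x.sign H = 0 <;> simp [sign_mul, sign_one, h]

/-- The support of a face: the intersection of the hyperplanes `H` with `σ_H(x) = 0`. -/
def supp (x : A.Face) : Submodule ℝ (Fin d → ℝ) :=
  ⨅ H : {H : A.hyperplanes // x.sign H = 0}, H.1.1

end Face

/-- The intersection lattice: the set of supports of faces, ordered by inclusion. -/
abbrev IntersectionLattice : Type :=
  {X : Submodule ℝ (Fin d → ℝ) // X ∈ Set.range (Face.supp : A.Face → _)}

/-- The face semigroup algebra: the monoid algebra of the face semigroup. -/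
abbrev FaceAlgebra (k : Type*) [Field k] : Type _ := MonoidAlgebra k A.Face

end CentralArrangement

/-! The face algebra is the opposite of an algebra `PosetAlgebra k 𝓛` whose presentation mentions
only the covering relation of the intersection lattice 𝓛. Isomorphic lattices therefore have
isomorphic face algebras.

To identify the two, let M be the space of functions on the faces, where a face y sends the basis
vector of x to that of yx if supp y ≤ supp x, and to 0 otherwise. One face chosen in each support
gives a vector `gen`. By triangularity with respect to the support (`mem_of_act_gen_mem`), M is free
of rank one on `gen`, so its commutant is the opposite of the face algebra. The projections to the
supports and the cellular coboundary `diff` lie in this commutant (`diff_mul_act`) and satisfy the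
relations of the poset algebra. The relation `diff² = 0` is the diamond property of faces, with
signs supplied by the exterior algebra (`exists_incidence_form`).

The resulting map from the poset algebra to the commutant is bijective because of exactness. The
faces inside a flat Y decompose a real vector space into convex cones, and their coboundary complex,
augmented at the top by the sum of coefficients, is exact (`exists_diff_eq`). Exactness in the top
degree gives surjectivity, and exactness one degree below shows that there are no further relations;
both arguments are inductions on Y. The characteristic plays no role: nonzero incidence numbers are
signs, hence invertible in k. -/

/-- The relations of the algebra of a finite poset: orthogonal idempotents `some X` with sum one,
and an element `none` of square zero, whose component from `X` to `Y` vanishes unless `Y`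
covers `X`. -/
inductive PosetRel (k P : Type*) [Field k] [PartialOrder P] [Fintype P] :
    FreeAlgebra k (Option P) → FreeAlgebra k (Option P) → Prop
  | idem (X : P) : PosetRel k P
      (FreeAlgebra.ι k (some X) * FreeAlgebra.ι k (some X)) (FreeAlgebra.ι k (some X))
  | orth (X Y : P) : X ≠ Y → PosetRel k P
      (FreeAlgebra.ι k (some X) * FreeAlgebra.ι k (some Y)) 0
  | sum : PosetRel k P (∑ X : P, FreeAlgebra.ι k (some X)) 1
  | cover (X Y : P) : ¬ X ⋖ Y → PosetRel k P
      (FreeAlgebra.ι k (some Y) * FreeAlgebra.ι k none * FreeAlgebra.ι k (some X)) 0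
  | sq : PosetRel k P (FreeAlgebra.ι k none * FreeAlgebra.ι k none) 0

/-- The algebra presented by `PosetRel`: the path algebra of the Hasse diagram of `P` modulo the
sums of all paths of length two between two given elements. -/
abbrev PosetAlgebra (k P : Type*) [Field k] [PartialOrder P] [Fintype P] : Type _ :=
  RingQuot (PosetRel k P)

/-! ### Normal forms in the poset algebra -/

namespace PosetAlgebra

variable {k P : Type*} [Field k] [PartialOrder P] [Fintype P]

/-- The idempotent at `X`. -/
def e (X : P) : PosetAlgebra k P := RingQuot.mkAlgHom k (PosetRel k P) (FreeAlgebra.ι k (some X))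

variable (k P) in
/-- The sum of all arrows. -/
def d : PosetAlgebra k P := RingQuot.mkAlgHom k (PosetRel k P) (FreeAlgebra.ι k none)

theorem e_mul_self (X : P) : (e X * e X : PosetAlgebra k P) = e X := by
  simpa [e] using RingQuot.mkAlgHom_rel k (PosetRel.idem (k := k) X)

theorem e_mul_of_ne {X Y : P} (h : X ≠ Y) : (e X * e Y : PosetAlgebra k P) = 0 := by
  simpa [e] using RingQuot.mkAlgHom_rel k (PosetRel.orth (k := k) X Y h)

theorem sum_e : ∑ X : P, (e X : PosetAlgebra k P) = 1 := by
  simpa [e] using RingQuot.mkAlgHom_rel k (PosetRel.sum (k := k) (P := P))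

theorem e_d_e {X Y : P} (h : ¬ X ⋖ Y) : (e Y * d k P * e X : PosetAlgebra k P) = 0 := by
  simpa [e, d] using RingQuot.mkAlgHom_rel k (PosetRel.cover (k := k) X Y h)

theorem d_mul_d : d k P * d k P = 0 := by
  simpa [d] using RingQuot.mkAlgHom_rel k (PosetRel.sq (k := k) (P := P))

theorem induction {C : PosetAlgebra k P → Prop} (h1 : ∀ r : k, C (algebraMap k _ r))
    (he : ∀ X, C (e X)) (hd : C (d k P)) (hmul : ∀ a b, C a → C b → C (a * b))
    (hadd : ∀ a b, C a → C b → C (a + b)) (b : PosetAlgebra k P) : C b := by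
  obtain ⟨a, rfl⟩ := RingQuot.mkAlgHom_surjective k (PosetRel k P) b
  induction a using FreeAlgebra.induction with
  | grade0 r => simpa using h1 r
  | grade1 x => cases x with
    | none => exact hd
    | some X => exact he X
  | mul a b ha hb => simpa using hmul _ _ ha hb
  | add a b ha hb => simpa using hadd _ _ ha hb

/-- A path ending at Y is either trivial or has a last arrow, which comes from some Z covered by Y.
This is what makes induction on Y possible. -/
theorem exists_e_mul_eq (b : PosetAlgebra k P) (Y : P) :
    ∃ (c : k) (b' : PosetAlgebra k P), e Y * b = c • e Y + e Y * d k P * b' := by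
  classical
  revert Y
  induction b using PosetAlgebra.induction with
  | h1 r => exact fun Y => ⟨r, 0, by simp [Algebra.algebraMap_eq_smul_one]⟩
  | he X =>
    intro Y
    by_cases h : Y = X
    · subst h; exact ⟨1, 0, by simp [e_mul_self]⟩
    · exact ⟨0, 0, by simp [e_mul_of_ne h]⟩
  | hd => exact fun Y => ⟨0, 1, by simp⟩
  | hmul a b ha hb =>
    intro Y
    obtain ⟨c, a', h⟩ := ha Y
    obtain ⟨c', b', h'⟩ := hb Y
    refine ⟨c * c', c • b' + a' * b, ?_⟩
    rw [← mul_assoc, h, add_mul, smul_mul_assoc, h', smul_add, smul_smul, mul_add, add_assoc,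
      mul_smul_comm, mul_assoc _ a' b]
  | hadd a b ha hb =>
    intro Y
    obtain ⟨c, a', h⟩ := ha Y
    obtain ⟨c', b', h'⟩ := hb Y
    refine ⟨c + c', a' + b', ?_⟩
    rw [mul_add, h, h', add_smul, mul_add]
    abel

theorem e_mul_d_mul (b : PosetAlgebra k P) (Y : P) :
    e Y * d k P * b = ∑ Z, e Y * d k P * e Z * (e Z * b) := by
  simp_rw [mul_assoc _ (e _) (e _ * b), ← mul_assoc (e _) (e _) b, e_mul_self]
  rw [← Finset.mul_sum, ← Finset.sum_mul, sum_e, one_mul]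

end PosetAlgebra

/-! ### Recognition of an algebra as the opposite of a poset algebra -/

/-- A free module of rank one over an algebra, split into summands indexed by a poset, with a
differential whose components form the beginning of resolutions of one-dimensional modules. -/
structure PosetModel (k P A M : Type*) [Field k] [PartialOrder P] [Fintype P] [Ring A]
    [Algebra k A] [AddCommGroup M] [Module k M] where
  action : A →ₐ[k] Module.End k M
  gen : M
  bijective_gen : Function.Bijective fun a => action a gen
  proj : P → Module.End k M
  diff : Module.End k M
  aug : P → M →ₗ[k] k
  proj_action : ∀ X a, proj X * action a = action a * proj X
  diff_action : ∀ a, diff * action a = action a * diff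
  proj_mul_self : ∀ X, proj X * proj X = proj X
  proj_mul_of_ne : ∀ X Y, X ≠ Y → proj X * proj Y = 0
  sum_proj : ∑ X, proj X = 1
  proj_diff_proj : ∀ X Y, ¬ X ⋖ Y → proj Y * diff * proj X = 0
  diff_mul_diff : diff * diff = 0
  aug_gen : ∀ X, aug X (proj X gen) = 1
  aug_diff : ∀ Y p, aug Y (proj Y (diff p)) = 0
  exists_diff_of_aug : ∀ Y p, aug Y (proj Y p) = 0 → ∃ r, proj Y (diff r) = proj Y p
  exists_diff_of_diff : ∀ Y p, proj Y (diff p) = 0 →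
    ∃ r, ∀ Z, Z ⋖ Y → proj Z p = proj Z (diff r)

namespace PosetModel

variable {k P A M : Type*} [Field k] [PartialOrder P] [Fintype P] [Ring A]
  [Algebra k A] [AddCommGroup M] [Module k M] (D : PosetModel k P A M)

/-- The endomorphisms commuting with the action. -/
def commutant : Subalgebra k (Module.End k M) :=
  Subalgebra.centralizer k (Set.range D.action)

theorem mem_commutant {T : Module.End k M} :
    T ∈ D.commutant ↔ ∀ a, D.action a * T = T * D.action a := by
  simp [commutant, Subalgebra.mem_centralizer_iff]

theorem eq_zero_of_gen {T : Module.End k M} (hT : T ∈ D.commutant) (h : T D.gen = 0) : T = 0 := by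
  ext v
  obtain ⟨a, rfl⟩ := D.bijective_gen.2 v
  have := LinearMap.congr_fun (D.mem_commutant.1 hT a) D.gen
  simp only [Module.End.mul_apply, h, map_zero] at this
  simp [← this]

/-- Freeness makes a·gen ↦ a·v well defined; under M ≅ A it is a right multiplication. -/
theorem exists_of_gen (v : M) : ∃ T ∈ D.commutant, T D.gen = v := by
  let orb (w : M) : A →ₗ[k] M := (LinearMap.applyₗ w).comp D.action.toLinearMap
  let f : A ≃ₗ[k] M := LinearEquiv.ofBijective (orb D.gen) D.bijective_gen
  have hf : ∀ a, f a = D.action a D.gen := fun a => rfl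
  have h1 : f.symm D.gen = 1 := by rw [f.symm_apply_eq, hf]; simp
  refine ⟨(orb v).comp f.symm.toLinearMap, D.mem_commutant.2 fun a => ?_, ?_⟩
  · ext w
    obtain ⟨b, rfl⟩ := f.surjective w
    have : D.action a (f b) = f (a * b) := by simp [hf]
    simp [this, orb]
  · simp [h1, orb]

theorem proj_mem (X : P) : D.proj X ∈ D.commutant :=
  D.mem_commutant.2 fun a => (D.proj_action X a).symm

theorem diff_mem : D.diff ∈ D.commutant :=
  D.mem_commutant.2 fun a => (D.diff_action a).symm

/-- The representation of the poset algebra. -/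
def rep : PosetAlgebra k P →ₐ[k] Module.End k M :=
  RingQuot.liftAlgHom k ⟨FreeAlgebra.lift k fun x => x.elim D.diff D.proj, by
    intro x y h
    cases h with
    | idem X => simpa using D.proj_mul_self X
    | orth X Y h => simpa using D.proj_mul_of_ne X Y h
    | sum => simpa using D.sum_proj
    | cover X Y h => simpa using D.proj_diff_proj X Y h
    | sq => simpa using D.diff_mul_diff⟩

@[simp]
theorem rep_e (X : P) : D.rep (PosetAlgebra.e X) = D.proj X := by
  simp [rep, PosetAlgebra.e]

@[simp]
theorem rep_d : D.rep (PosetAlgebra.d k P) = D.diff := by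
  simp [rep, PosetAlgebra.d]

theorem rep_mem (b : PosetAlgebra k P) : D.rep b ∈ D.commutant := by
  induction b using PosetAlgebra.induction with
  | h1 r => simp
  | he X => simpa using D.proj_mem X
  | hd => simpa using D.diff_mem
  | hmul a b ha hb => simpa using D.commutant.mul_mem ha hb
  | hadd a b ha hb => simpa using D.commutant.add_mem ha hb

theorem proj_diff_eq (Y : P) (T : Module.End k M) :
    D.proj Y * D.diff * T = ∑ Z, D.proj Y * D.diff * D.proj Z * (D.proj Z * T) := by
  simp_rw [mul_assoc _ (D.proj _) (D.proj _ * T), ← mul_assoc (D.proj _) (D.proj _) T,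
    D.proj_mul_self]
  rw [← Finset.mul_sum, ← Finset.sum_mul, D.sum_proj, one_mul]

/-- Surjectivity of `rep`. After subtracting a multiple of `proj Y`, the value at `gen` has
augmentation zero, so by exactness in the top degree it factors through `diff`. Only the components
at Z ⋖ Y of the other factor matter, and induction applies to them. -/
theorem proj_mul_mem_range (Y : P) :
    ∀ T ∈ D.commutant, D.proj Y * T ∈ D.rep.range := by
  induction Y using WellFoundedLT.induction with
  | ind Y ih =>
    intro T hT
    set c := D.aug Y (D.proj Y (T D.gen)) with hc
    obtain ⟨r, hr⟩ := D.exists_diff_of_aug Y (T D.gen - c • D.gen) (by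
      simp [D.aug_gen, ← hc])
    obtain ⟨T', hT', rfl⟩ := D.exists_of_gen r
    have key : D.proj Y * D.diff * T' - (D.proj Y * T - c • D.proj Y) = 0 := by
      refine D.eq_zero_of_gen ?_ ?_
      · exact sub_mem (mul_mem (mul_mem (D.proj_mem Y) D.diff_mem) hT')
          (sub_mem (mul_mem (D.proj_mem Y) hT) (D.commutant.smul_mem (D.proj_mem Y) c))
      · simp only [LinearMap.sub_apply, Module.End.mul_apply, hr]
        simp
    have : D.proj Y * T = c • D.proj Y + D.proj Y * D.diff * T' := by
      rw [sub_eq_zero.1 key]; abel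
    rw [this, D.proj_diff_eq]
    refine add_mem (D.rep.range.smul_mem ⟨_, D.rep_e Y⟩ c) (sum_mem fun Z _ => ?_)
    by_cases hZ : Z ⋖ Y
    · refine mul_mem ?_ (ih Z hZ.lt T' hT')
      exact ⟨PosetAlgebra.e Y * PosetAlgebra.d k P * PosetAlgebra.e Z, by simp⟩
    · rw [D.proj_diff_proj Z Y hZ, zero_mul]; exact zero_mem _

theorem mem_range_rep {T : Module.End k M} (hT : T ∈ D.commutant) : ∃ b, D.rep b = T := by
  have : T = ∑ Y, D.proj Y * T := by rw [← Finset.sum_mul, D.sum_proj, one_mul]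
  rw [this]
  exact (sum_mem fun Y _ => D.proj_mul_mem_range Y T hT : _ ∈ D.rep.range)

/-- Injectivity of `rep`. The augmentation kills the trivial path, leaving e_Y d b'. Exactness one
degree lower, surjectivity of `rep` and induction give e_Z b' = e_Z d b'' for every Z ⋖ Y, whence
e_Y d b' = e_Y d d b'' = 0. -/
theorem e_mul_eq_zero (Y : P) :
    ∀ b, D.proj Y * D.rep b = 0 → PosetAlgebra.e Y * b = 0 := by
  induction Y using WellFoundedLT.induction with
  | ind Y ih =>
    intro b hb
    obtain ⟨c, b', h⟩ := PosetAlgebra.exists_e_mul_eq b Y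
    have h2 : c • D.proj Y + D.proj Y * D.diff * D.rep b' = 0 := by
      have := congrArg D.rep h
      simp only [map_mul, map_add, map_smul, rep_e, rep_d] at this
      rw [← this, hb]
    have hc : c = 0 := by
      have := congrArg (D.aug Y) (LinearMap.congr_fun h2 D.gen)
      simpa [D.aug_gen, D.aug_diff] using this
    subst hc
    rw [zero_smul, zero_add] at h2 h
    obtain ⟨r, hr⟩ := D.exists_diff_of_diff Y (D.rep b' D.gen) (by
      simpa using LinearMap.congr_fun h2 D.gen)
    obtain ⟨T', hT', rfl⟩ := D.exists_of_gen r
    obtain ⟨b'', rfl⟩ := D.mem_range_rep hT'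
    have hZ : ∀ Z, Z ⋖ Y →
        PosetAlgebra.e Z * b' = PosetAlgebra.e Z * (PosetAlgebra.d k P * b'') := by
      intro Z hZ
      rw [← sub_eq_zero, ← mul_sub]
      refine ih Z hZ.lt _ (D.eq_zero_of_gen (mul_mem (D.proj_mem Z) (D.rep_mem _)) ?_)
      simp [hr Z hZ]
    have : PosetAlgebra.e Y * PosetAlgebra.d k P * b' =
        PosetAlgebra.e Y * PosetAlgebra.d k P * (PosetAlgebra.d k P * b'') := by
      rw [PosetAlgebra.e_mul_d_mul b', PosetAlgebra.e_mul_d_mul (PosetAlgebra.d k P * b'')]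
      refine Finset.sum_congr rfl fun Z _ => ?_
      by_cases h : Z ⋖ Y
      · rw [hZ Z h]
      · rw [PosetAlgebra.e_d_e h, zero_mul, zero_mul]
    rw [h, this, mul_assoc, ← mul_assoc (PosetAlgebra.d k P), PosetAlgebra.d_mul_d, zero_mul,
      mul_zero]

theorem rep_injective : Function.Injective D.rep := by
  rw [injective_iff_map_eq_zero]
  intro b hb
  rw [← one_mul b, ← PosetAlgebra.sum_e, Finset.sum_mul]
  exact Finset.sum_eq_zero fun Y _ => D.e_mul_eq_zero Y b (by rw [hb, mul_zero])

theorem nonempty_algEquiv (D : PosetModel k P A M) :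
    Nonempty ((PosetAlgebra k P)ᵐᵒᵖ ≃ₐ[k] A) := by
  let f : A ≃ₗ[k] M := LinearEquiv.ofBijective
    ((LinearMap.applyₗ D.gen).comp D.action.toLinearMap) D.bijective_gen
  have hf : ∀ a, f a = D.action a D.gen := fun a => rfl
  -- Here b goes to the unique a with a·gen = b·gen. Products are reversed because b commutes with
  -- the action.
  let g : (PosetAlgebra k P)ᵐᵒᵖ →ₗ[k] A := (f.symm.toLinearMap ∘ₗ LinearMap.applyₗ D.gen ∘ₗ
    D.rep.toLinearMap) ∘ₗ (MulOpposite.opLinearEquiv k).symm.toLinearMap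
  have hg : ∀ b, D.action (g b) D.gen = D.rep b.unop D.gen := fun b => by
    rw [← hf]; simp [g]
  let G : (PosetAlgebra k P)ᵐᵒᵖ →ₐ[k] A := AlgHom.ofLinearMap g
    (D.bijective_gen.1 (by simp [hg])) fun x y => D.bijective_gen.1 (by
      have := LinearMap.congr_fun (D.mem_commutant.1 (D.rep_mem y.unop) (g x)) D.gen
      simp only [Module.End.mul_apply] at this
      simp [hg, this])
  refine ⟨AlgEquiv.ofBijective G ⟨?_, ?_⟩⟩
  · rw [injective_iff_map_eq_zero]
    intro b hb
    have h : D.rep b.unop D.gen = 0 := by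
      rw [← hg b, show g b = 0 from hb]; simp
    have := D.rep_injective ((D.eq_zero_of_gen (D.rep_mem _) h).trans (map_zero D.rep).symm)
    exact MulOpposite.unop_injective this
  · intro a
    obtain ⟨T, hT, h⟩ := D.exists_of_gen (D.action a D.gen)
    obtain ⟨b, rfl⟩ := D.mem_range_rep hT
    exact ⟨MulOpposite.op b, D.bijective_gen.1 ((hg _).trans h)⟩

end PosetModel

/-! ### Orientations of subspaces through exterior products -/

section Orientation

open Module ExteriorAlgebra

variable {K V : Type*} [Field K] [AddCommGroup V] [Module K V]

/-- Over a field the exterior algebra of the span embeds in that of V, and on the span the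
determinant takes the value 1 on this product. -/
theorem ExteriorAlgebra.ιMulti_ne_zero {n : ℕ} {w : Fin n → V} (hw : LinearIndependent K w) :
    ιMulti K n w ≠ 0 := by
  intro h
  set b := Basis.span hw
  have hb : (Submodule.span K (Set.range w)).subtype ∘ b = w := by
    ext i; simp [b, Basis.span_apply]
  have h0 : ιMulti K n b = 0 := by
    refine ExteriorAlgebra.map_injective_field (f := (Submodule.span K (Set.range w)).subtype)
      (Submodule.ker_subtype _) ?_
    rw [map_apply_ιMulti, hb, h, map_zero]
  have h1 : liftAlternating (R := K) (Function.update 0 n b.det) (ιMulti K n b) = 1 := by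
    rw [liftAlternating_apply_ιMulti, Function.update_self, Basis.det_self]
  rw [h0, map_zero] at h1
  exact zero_ne_one h1

theorem ExteriorAlgebra.ιMulti_eq_det_smul {n : ℕ} (b : Basis (Fin n) K V) (w : Fin n → V) :
    ιMulti K n w = b.det w • ιMulti K n b := by
  rw [← sub_eq_zero, ← Module.forall_dual_apply_eq_zero_iff K]
  intro φ
  have := congrArg (fun f => f w)
    (AlternatingMap.eq_smul_basis_det b (φ.compAlternatingMap (ιMulti K n)))
  simp only [LinearMap.compAlternatingMap_apply, AlternatingMap.smul_apply, smul_eq_mul] at this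
  rw [map_sub, this, map_smul, smul_eq_mul, mul_comm, sub_self]

variable [FiniteDimensional K V]

/-- The exterior product of a basis of a subspace. -/
noncomputable def Submodule.volume (X : Submodule K V) : ExteriorAlgebra K V :=
  ιMulti K (finrank K X) fun i => (finBasis K X i : V)

theorem Submodule.linearIndependent_finBasis (X : Submodule K V) :
    LinearIndependent K fun i => (finBasis K X i : V) :=
  (finBasis K X).linearIndependent.map' X.subtype X.ker_subtype

theorem Submodule.span_finBasis (X : Submodule K V) :
    Submodule.span K (Set.range fun i => (finBasis K X i : V)) = X := by
  have := congrArg (Submodule.map X.subtype) (finBasis K X).span_eq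
  rw [Submodule.map_span, ← Set.range_comp, Submodule.map_top, Submodule.range_subtype] at this
  exact this

theorem Submodule.ι_mul_volume (X : Submodule K V) (v : V) :
    ι K v * X.volume =
      ιMulti K (finrank K X + 1) (Fin.cons v fun i => (finBasis K X i : V)) := by
  rw [ιMulti_succ_apply]
  rfl

theorem Submodule.ι_mul_volume_eq_zero_iff (X : Submodule K V) (v : V) :
    ι K v * X.volume = 0 ↔ v ∈ X := by
  rw [X.ι_mul_volume]
  constructor
  · intro h
    by_contra hv
    refine ExteriorAlgebra.ιMulti_ne_zero (linearIndependent_finCons.2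
      ⟨X.linearIndependent_finBasis, ?_⟩) h
    rwa [X.span_finBasis]
  · intro hv
    refine AlternatingMap.map_linearDependent _ _ fun h => ?_
    have := (linearIndependent_finCons.1 h).2
    rw [X.span_finBasis] at this
    exact this hv

theorem Submodule.exists_ιMulti_eq_smul_volume (Y : Submodule K V) {n : ℕ} (h : finrank K Y = n)
    (w : Fin n → Y) : ∃ c : K, ιMulti K n (Y.subtype ∘ w) = c • Y.volume := by
  subst h
  have hb : (fun i => (finBasis K Y i : V)) = Y.subtype ∘ finBasis K Y := rfl
  exact ⟨(finBasis K Y).det w, by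
    rw [Submodule.volume, hb, ← map_apply_ιMulti, ← map_apply_ιMulti,
      ExteriorAlgebra.ιMulti_eq_det_smul (finBasis K Y) w, map_smul]⟩

theorem Submodule.exists_ι_mul_volume {X Y : Submodule K V} (hXY : X ≤ Y)
    (h : finrank K Y = finrank K X + 1) {v : V} (hv : v ∈ Y) :
    ∃ c : K, ι K v * X.volume = c • Y.volume := by
  rw [X.ι_mul_volume]
  convert Y.exists_ιMulti_eq_smul_volume h
    (Fin.cons ⟨v, hv⟩ fun i => ⟨finBasis K X i, hXY (finBasis K X i).2⟩) using 4
  funext i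
  refine Fin.cases ?_ (fun j => ?_) i <;> simp

variable (K V) in
/-- Linear forms cutting out a subspace in every subspace of one dimension more, which satisfy the
sign rule of the cellular boundary. -/
theorem exists_incidence_form : ∃ o : Submodule K V → Submodule K V → V →ₗ[K] K,
    (∀ X Y : Submodule K V, X ≤ Y → finrank K Y = finrank K X + 1 → ∀ v ∈ Y, o X Y v = 0 ↔ v ∈ X) ∧
    (∀ W Z Z' Y : Submodule K V, W ≤ Z → finrank K Z = finrank K W + 1 → W ≤ Z' →
      finrank K Z' = finrank K W + 1 → Z ≤ Y → finrank K Y = finrank K Z + 1 → Z' ≤ Y →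
      ∀ z ∈ Z, ∀ z' ∈ Z', o W Z z * o Z Y z' + o W Z' z' * o Z' Y z = 0) := by
  have hne : ∀ Y : Submodule K V, Y.volume ≠ 0 := fun Y =>
    ExteriorAlgebra.ιMulti_ne_zero Y.linearIndependent_finBasis
  choose f hf using fun Y : Submodule K V => Projective.exists_dual_eq_one K (hne Y)
  -- The coefficient of v ∧ vol X with respect to vol Y. The sign rule then follows from z ∧ z' =
  -- −z' ∧ z.
  let o : Submodule K V → Submodule K V → V →ₗ[K] K := fun X Y =>
    f Y ∘ₗ LinearMap.mulRight K X.volume ∘ₗ ι K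
  have ho : ∀ X Y : Submodule K V, X ≤ Y → finrank K Y = finrank K X + 1 → ∀ v ∈ Y,
      ι K v * X.volume = o X Y v • Y.volume := by
    intro X Y hXY h v hv
    obtain ⟨c, hc⟩ := Submodule.exists_ι_mul_volume hXY h hv
    have : o X Y v = c := by simp [o, hc, hf]
    rw [this, hc]
  refine ⟨o, fun X Y hXY h v hv => ?_, ?_⟩
  · rw [← X.ι_mul_volume_eq_zero_iff, ho X Y hXY h v hv, smul_eq_zero, or_iff_left (hne Y)]
  · intro W Z Z' Y hWZ h1 hWZ' h2 hZY h3 hZY' z hz z' hz'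
    have e1 : ι K z' * (ι K z * W.volume) = (o W Z z * o Z Y z') • Y.volume := by
      rw [ho W Z hWZ h1 z hz, mul_smul_comm, ho Z Y hZY h3 z' (hZY' hz'), smul_smul]
    have e2 : ι K z * (ι K z' * W.volume) = (o W Z' z' * o Z' Y z) • Y.volume := by
      rw [ho W Z' hWZ' h2 z' hz', mul_smul_comm, ho Z' Y hZY' (by omega) z (hZY hz), smul_smul]
    have e3 := congrArg (· * W.volume) (ι_add_mul_swap (R := K) z' z)
    simp only [add_mul, mul_assoc, zero_mul] at e3
    rw [e1, e2, ← add_smul, smul_eq_zero, or_iff_left (hne Y)] at e3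
    exact e3

end Orientation

/-! ### Faces, supports and the grading by dimension -/

namespace CentralArrangement

variable {d : ℕ} {A : CentralArrangement d}

namespace Face

/-- A point of a face. -/
noncomputable def pt (x : A.Face) : Fin d → ℝ := x.nonempty.choose

theorem sign_pt (x : A.Face) (H : A.hyperplanes) :
    SignType.sign (A.form H x.pt) = x.sign H :=
  A.mem_region.1 x.nonempty.choose_spec H

/-- The face containing a point. -/
noncomputable def ofPoint (A : CentralArrangement d) (v : Fin d → ℝ) : A.Face where
  sign H := SignType.sign (A.form H v)
  nonempty := ⟨v, A.mem_region.2 fun _ => rfl⟩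

@[simp]
theorem sign_ofPoint (v : Fin d → ℝ) (H : A.hyperplanes) :
    (ofPoint A v).sign H = SignType.sign (A.form H v) := rfl

instance : Neg A.Face where
  neg x :=
    { sign := fun H => -x.sign H
      nonempty := ⟨-x.pt, A.mem_region.2 fun H => by
        rw [map_neg, Left.sign_neg, sign_pt]⟩ }

@[simp]
theorem sign_neg (x : A.Face) (H : A.hyperplanes) : (-x).sign H = -x.sign H := rfl

theorem sign_injective : Function.Injective (sign : A.Face → A.hyperplanes → SignType) :=
  fun _ _ h => Face.ext h

instance : Finite A.Face := Finite.of_injective _ sign_injective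

noncomputable instance : Fintype A.Face := Fintype.ofFinite _

theorem sign_mul_eq_zero {x y : A.Face} {H : A.hyperplanes} :
    (x * y).sign H = 0 ↔ x.sign H = 0 ∧ y.sign H = 0 := by
  rw [sign_mul]; split_ifs with h <;> simp_all

theorem sign_mul_of_ne {x : A.Face} (y : A.Face) {H : A.hyperplanes} (h : x.sign H ≠ 0) :
    (x * y).sign H = x.sign H := by simp [sign_mul, h]

theorem sign_mul_of_eq {x : A.Face} (y : A.Face) {H : A.hyperplanes} (h : x.sign H = 0) :
    (x * y).sign H = y.sign H := by simp [sign_mul, h]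

theorem le_mul (x y : A.Face) : x ≤ x * y := fun H => by
  by_cases h : x.sign H = 0
  · exact Or.inl h
  · exact Or.inr (sign_mul_of_ne y h).symm

theorem mul_le {x y z : A.Face} (hx : x ≤ z) (hy : y ≤ z) : x * y ≤ z := fun H => by
  by_cases h : x.sign H = 0
  · rw [sign_mul_of_eq y h]; exact hy H
  · rw [sign_mul_of_ne y h]; exact hx H

theorem mul_eq_of_le {x y : A.Face} (h : x ≤ y) : x * y = y := by
  ext1; funext H
  rcases h H with h | h
  · exact sign_mul_of_eq y h
  · by_cases h0 : x.sign H = 0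
    · exact sign_mul_of_eq y h0
    · rw [sign_mul_of_ne y h0, h]

theorem mem_supp {x : A.Face} {v : Fin d → ℝ} :
    v ∈ x.supp ↔ ∀ H, x.sign H = 0 → A.form H v = 0 := by
  simp only [supp, Submodule.mem_iInf, Subtype.forall]
  refine forall₂_congr fun H hH => ?_
  refine forall_congr' fun _ => ?_
  rw [← LinearMap.mem_ker, A.ker_form]

theorem pt_mem_supp (x : A.Face) : x.pt ∈ x.supp :=
  mem_supp.2 fun H h => by rwa [← sign_pt, sign_eq_zero_iff] at h

theorem sign_eq_zero_of_supp_le {x : A.Face} {H : A.hyperplanes}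
    (h : x.supp ≤ LinearMap.ker (A.form H)) : x.sign H = 0 := by
  rw [← sign_pt, sign_eq_zero_iff]
  exact h x.pt_mem_supp

theorem supp_le_ker {x : A.Face} {H : A.hyperplanes} (h : x.sign H = 0) :
    x.supp ≤ LinearMap.ker (A.form H) := fun _ hv => mem_supp.1 hv H h

theorem supp_le_supp {x y : A.Face} :
    x.supp ≤ y.supp ↔ ∀ H, y.sign H = 0 → x.sign H = 0 := by
  constructor
  · exact fun h H hy => sign_eq_zero_of_supp_le (h.trans (supp_le_ker hy))
  · exact fun h v hv => mem_supp.2 fun H hy => mem_supp.1 hv H (h H hy)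

/-- The support of a face, as an element of the intersection lattice. -/
def flat (x : A.Face) : A.IntersectionLattice := ⟨x.supp, x, rfl⟩

theorem flat_surjective : Function.Surjective (flat : A.Face → A.IntersectionLattice) := by
  rintro ⟨_, x, rfl⟩
  exact ⟨x, rfl⟩

theorem flat_le {x y : A.Face} : x.flat ≤ y.flat ↔ ∀ H, y.sign H = 0 → x.sign H = 0 :=
  supp_le_supp

theorem flat_eq {x y : A.Face} : x.flat = y.flat ↔ ∀ H, x.sign H = 0 ↔ y.sign H = 0 := by
  rw [le_antisymm_iff, flat_le, flat_le, ← forall_and]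
  exact forall_congr' fun H => by tauto

theorem flat_mono {x y : A.Face} (h : x ≤ y) : x.flat ≤ y.flat :=
  flat_le.2 fun H hy => (h H).elim id fun h => h.trans hy

theorem eq_of_le_of_flat_le {x y : A.Face} (h : x ≤ y) (h' : y.flat ≤ x.flat) : x = y := by
  ext1; funext H
  rcases h H with h0 | h0
  · rw [h0, flat_le.1 h' H h0]
  · exact h0

theorem flat_lt_of_lt {x y : A.Face} (h : x < y) : x.flat < y.flat :=
  lt_of_le_not_ge (flat_mono h.le) fun h' => h.ne (eq_of_le_of_flat_le h.le h')

theorem flat_mul_le {x y z : A.Face} :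
    (x * y).flat ≤ z.flat ↔ x.flat ≤ z.flat ∧ y.flat ≤ z.flat := by
  simp only [flat_le, sign_mul_eq_zero]
  exact ⟨fun h => ⟨fun H hz => (h H hz).1, fun H hz => (h H hz).2⟩,
    fun h H hz => ⟨h.1 H hz, h.2 H hz⟩⟩

theorem le_flat_mul_left (x y : A.Face) : x.flat ≤ (x * y).flat := flat_mono (le_mul x y)

theorem le_flat_mul_right (x y : A.Face) : y.flat ≤ (x * y).flat :=
  flat_le.2 fun _ h => (sign_mul_eq_zero.1 h).2

theorem flat_mul_of_le {x y : A.Face} (h : x.flat ≤ y.flat) : (x * y).flat = y.flat :=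
  le_antisymm (flat_mul_le.2 ⟨h, le_rfl⟩) (le_flat_mul_right x y)

theorem flat_mul_of_ge {x y : A.Face} (h : y.flat ≤ x.flat) : (x * y).flat = x.flat :=
  le_antisymm (flat_mul_le.2 ⟨le_rfl, h⟩) (le_flat_mul_left x y)

theorem flat_neg (x : A.Face) : (-x).flat = x.flat :=
  flat_eq.2 fun H => by simp [SignType.neg_eq_zero_iff]

theorem mul_eq_left {x y : A.Face} (h : y.flat ≤ x.flat) : x * y = x :=
  (eq_of_le_of_flat_le (le_mul x y) (flat_mul_of_ge h).le).symm

/-- Every intersection of a support with a hyperplane of the arrangement is a support. -/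
theorem exists_supp_eq_inf (y : A.Face) (H : A.hyperplanes) :
    ∃ f : A.Face, f.supp = y.supp ⊓ LinearMap.ker (A.form H) := by
  let S : Set A.Face := {x | x.flat ≤ y.flat ∧ x.sign H = 0}
  have h1 : (1 : A.Face) ∈ S := ⟨flat_le.2 fun _ _ => rfl, rfl⟩
  -- Multiplying a face of maximal support by the face of any point v of the intersection stays in
  -- `S`, so maximality puts v in its support.
  obtain ⟨f, hf, hmax⟩ := (Set.toFinite S).exists_maximalFor flat S ⟨1, h1⟩
  refine ⟨f, le_antisymm (le_inf hf.1 (supp_le_ker hf.2)) fun v hv => ?_⟩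
  have hv' : f * ofPoint A v ∈ S := by
    refine ⟨flat_mul_le.2 ⟨hf.1, flat_le.2 fun H' h' => ?_⟩, sign_mul_eq_zero.2 ⟨hf.2, ?_⟩⟩
    · rw [sign_ofPoint, sign_eq_zero_iff]; exact mem_supp.1 hv.1 H' h'
    · rw [sign_ofPoint, sign_eq_zero_iff]; exact hv.2
  have h2 := (flat_mul_le.1 (hmax hv' (le_flat_mul_left _ _))).2
  refine mem_supp.2 fun H' h' => ?_
  have := flat_le.1 h2 H' h'
  rwa [sign_ofPoint, sign_eq_zero_iff] at this

theorem exists_sign_of_flat_lt {x y : A.Face} (h : x.flat < y.flat) :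
    ∃ H, x.sign H = 0 ∧ y.sign H ≠ 0 := by
  by_contra! h'
  exact h.not_ge (flat_le.2 h')

/-- The intersection on the right is itself a flat, strictly below that of y and above that of x.
Hence covering relations are exactly the steps of dimension one. -/
theorem supp_eq_inf_of_covBy {x y : A.Face} (h : x.flat ⋖ y.flat) {H : A.hyperplanes}
    (hx : x.sign H = 0) (hy : y.sign H ≠ 0) :
    x.supp = y.supp ⊓ LinearMap.ker (A.form H) := by
  obtain ⟨f, hf⟩ := y.exists_supp_eq_inf H
  have h1 : x.flat ≤ f.flat := by
    change x.supp ≤ f.supp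
    rw [hf]
    exact le_inf h.le (supp_le_ker hx)
  have h2 : f.flat < y.flat := by
    refine lt_of_le_not_ge (?_ : f.supp ≤ y.supp) fun h' : y.supp ≤ f.supp => hy ?_
    · rw [hf]; exact inf_le_left
    · rw [hf] at h'; exact sign_eq_zero_of_supp_le (h'.trans inf_le_right)
  rcases h1.eq_or_lt with h1 | h1
  · rw [← hf]; exact congrArg Subtype.val h1
  · exact (h.2 h1 h2).elim

theorem flat_le_of_covBy {x y u : A.Face} (h : x.flat ⋖ y.flat) {H : A.hyperplanes}
    (hx : x.sign H = 0) (hy : y.sign H ≠ 0) (hu : u.flat ≤ y.flat) (huH : u.sign H = 0) :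
    u.flat ≤ x.flat := by
  change u.supp ≤ x.supp
  rw [supp_eq_inf_of_covBy h hx hy]
  exact le_inf hu (supp_le_ker huH)

theorem finrank_supp_inf {y : A.Face} {H : A.hyperplanes} (hy : y.sign H ≠ 0) :
    Module.finrank ℝ y.supp =
      Module.finrank ℝ ↥(y.supp ⊓ LinearMap.ker (A.form H)) + 1 := by
  have h1 := Submodule.finrank_sup_add_finrank_inf_eq y.supp (LinearMap.ker (A.form H))
  have hne : ¬ y.supp ≤ LinearMap.ker (A.form H) := fun h => hy (sign_eq_zero_of_supp_le h)
  have h2 : Module.finrank ℝ (LinearMap.ker (A.form H)) + 1 = d := by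
    rw [A.ker_form]; exact A.isHyperplane _ H.2
  have h3 := Submodule.finrank_le (y.supp ⊔ LinearMap.ker (A.form H))
  have h4 : LinearMap.ker (A.form H) < y.supp ⊔ LinearMap.ker (A.form H) :=
    right_lt_sup.2 hne
  have h5 := Submodule.finrank_lt_finrank_of_lt h4
  rw [Module.finrank_fin_fun] at h3
  omega

theorem finrank_of_covBy {x y : A.Face} (h : x.flat ⋖ y.flat) :
    Module.finrank ℝ y.supp = Module.finrank ℝ x.supp + 1 := by
  obtain ⟨H, hx, hy⟩ := exists_sign_of_flat_lt h.lt
  rw [finrank_supp_inf hy, ← supp_eq_inf_of_covBy h hx hy]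

theorem finrank_lt {x y : A.Face} (h : x.flat < y.flat) :
    Module.finrank ℝ x.supp < Module.finrank ℝ y.supp :=
  Submodule.finrank_lt_finrank_of_lt h

theorem covBy_of_finrank {x y : A.Face} (h : x.flat < y.flat)
    (h' : Module.finrank ℝ y.supp = Module.finrank ℝ x.supp + 1) : x.flat ⋖ y.flat := by
  refine ⟨h, fun u h1 h2 => ?_⟩
  obtain ⟨u, rfl⟩ := flat_surjective u
  have := finrank_lt h1
  have := finrank_lt h2
  omega

/-! ### Incidence numbers and the diamond property -/

/-- The linear forms measuring orientations of covering pairs of subspaces. -/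
noncomputable def form (x z : A.Face) : (Fin d → ℝ) →ₗ[ℝ] ℝ :=
  (exists_incidence_form ℝ (Fin d → ℝ)).choose x.supp z.supp

theorem form_congr {x x' z z' : A.Face} (hx : x.flat = x'.flat) (hz : z.flat = z'.flat) :
    form x z = form x' z' := by
  have h1 : x.supp = x'.supp := congrArg Subtype.val hx
  have h2 : z.supp = z'.supp := congrArg Subtype.val hz
  rw [form, form, h1, h2]

theorem form_eq_zero {x z : A.Face} (h : x.flat ⋖ z.flat) {v : Fin d → ℝ} (hv : v ∈ z.supp) :
    form x z v = 0 ↔ v ∈ x.supp :=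
  (exists_incidence_form ℝ (Fin d → ℝ)).choose_spec.1 _ _ h.le (finrank_of_covBy h) v hv

theorem form_add {w z z' y : A.Face} (h1 : w.flat ⋖ z.flat) (h2 : w.flat ⋖ z'.flat)
    (h3 : z.flat ⋖ y.flat) (h4 : z'.flat ⋖ y.flat) :
    form w z z.pt * form z y z'.pt + form w z' z'.pt * form z' y z.pt = 0 :=
  (exists_incidence_form ℝ (Fin d → ℝ)).choose_spec.2 _ _ _ _ h1.le (finrank_of_covBy h1) h2.le
    (finrank_of_covBy h2) h3.le (finrank_of_covBy h3) h4.le _ z.pt_mem_supp _ z'.pt_mem_supp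

open Classical in
/-- The incidence numbers of the faces. -/
noncomputable def inc (x z : A.Face) : SignType :=
  if x ≤ z ∧ x.flat ⋖ z.flat then SignType.sign (form x z z.pt) else 0

theorem inc_of_covBy {x z : A.Face} (h : x ≤ z) (h' : x.flat ⋖ z.flat) :
    inc x z = SignType.sign (form x z z.pt) := if_pos ⟨h, h'⟩

theorem le_of_inc_ne {x z : A.Face} (h : inc x z ≠ 0) : x ≤ z := by
  by_contra h'
  exact h (if_neg fun h => h' h.1)

theorem covBy_of_inc_ne {x z : A.Face} (h : inc x z ≠ 0) : x.flat ⋖ z.flat := by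
  by_contra h'
  exact h (if_neg fun h => h' h.2)

theorem inc_ne_zero {x z : A.Face} (h : x ≤ z) (h' : x.flat ⋖ z.flat) : inc x z ≠ 0 := by
  rw [inc_of_covBy h h', Ne, sign_eq_zero_iff, form_eq_zero h' z.pt_mem_supp]
  intro hz
  refine h'.lt.not_ge (flat_le.2 fun H hx => ?_)
  rw [← sign_pt, sign_eq_zero_iff]
  exact mem_supp.1 hz H hx

/-- On supp z both forms have kernel supp x, so they are proportional. -/
theorem form_mul_form {x z : A.Face} (h : x.flat ⋖ z.flat) {H : A.hyperplanes}
    (hx : x.sign H = 0) (hz : z.sign H ≠ 0) {v w : Fin d → ℝ} (hv : v ∈ z.supp)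
    (hw : w ∈ z.supp) : A.form H v * form x z w = A.form H w * form x z v := by
  have h0 : A.form H v • w - A.form H w • v ∈ x.supp := by
    rw [supp_eq_inf_of_covBy h hx hz]
    refine ⟨sub_mem (Submodule.smul_mem _ _ hw) (Submodule.smul_mem _ _ hv), ?_⟩
    rw [SetLike.mem_coe, LinearMap.mem_ker, map_sub, map_smul, map_smul, smul_eq_mul, smul_eq_mul,
      mul_comm, sub_self]
  have := (form_eq_zero h (sub_mem (Submodule.smul_mem _ _ hw) (Submodule.smul_mem _ _ hv))).2 h0
  rw [map_sub, map_smul, map_smul, smul_eq_mul, smul_eq_mul] at this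
  linarith

/-- For fixed flats, the incidence number records the side of H on which z lies, up to a sign common
to all pairs of faces. -/
theorem sign_mul_inc {x x' z z' : A.Face} (hx : x.flat = x'.flat) (hz : z.flat = z'.flat)
    (h : x.flat ⋖ z.flat) (hxz : x ≤ z) (hxz' : x' ≤ z') {H : A.hyperplanes} (hH : x.sign H = 0) :
    z'.sign H * inc x z = z.sign H * inc x' z' := by
  by_cases hzH : z.sign H = 0
  · rw [hzH, (flat_eq.1 hz H).1 hzH, zero_mul, zero_mul]
  have hpt : z'.pt ∈ z.supp := by
    have e : z.supp = z'.supp := congrArg Subtype.val hz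
    rw [e]; exact z'.pt_mem_supp
  rw [inc_of_covBy hxz h, inc_of_covBy hxz' (hx ▸ hz ▸ h), ← form_congr hx hz, ← sign_pt,
    ← sign_pt, ← _root_.sign_mul, ← _root_.sign_mul, form_mul_form h hH hzH hpt z.pt_mem_supp]

theorem inc_eq {x x' z z' : A.Face} (hx : x.flat = x'.flat) (hz : z.flat = z'.flat)
    (h : x.flat ⋖ z.flat) (hxz : x ≤ z) (hxz' : x' ≤ z') {H : A.hyperplanes} (hH : x.sign H = 0)
    (hzH : z.sign H ≠ 0) (hs : z.sign H = z'.sign H) : inc x z = inc x' z' := by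
  have := sign_mul_inc hx hz h hxz hxz' hH
  rw [← hs] at this
  exact mul_left_cancel₀ hzH this

theorem inc_eq_neg {x x' z z' : A.Face} (hx : x.flat = x'.flat) (hz : z.flat = z'.flat)
    (h : x.flat ⋖ z.flat) (hxz : x ≤ z) (hxz' : x' ≤ z') {H : A.hyperplanes} (hH : x.sign H = 0)
    (hzH : z.sign H ≠ 0) (hs : z.sign H = -z'.sign H) : inc x z = -inc x' z' := by
  have := sign_mul_inc hx hz h hxz hxz' hH
  have h' : z'.sign H = -z.sign H := by rw [hs, neg_neg]
  rw [h', neg_mul, ← mul_neg] at this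
  refine mul_left_cancel₀ hzH ?_
  rw [mul_neg, ← this, mul_neg, neg_neg]

/-- Opposite faces covering `x` have opposite incidence numbers. -/
theorem inc_opposite {x z : A.Face} (h : x ≤ z) (h' : x.flat ⋖ z.flat) :
    inc x (x * -z) = -inc x z := by
  obtain ⟨H, hx, hz⟩ := exists_sign_of_flat_lt h'.lt
  have hf : (x * -z).flat = z.flat := by
    rw [flat_mul_of_le] <;> rw [flat_neg]
    exact h'.le
  refine inc_eq_neg (H := H) rfl hf (hf ▸ h') (le_mul _ _) h hx ?_ ?_ <;>
    rw [sign_mul_of_eq _ hx, sign_neg]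
  rwa [Ne, SignType.neg_eq_zero_iff]

theorem opposite_opposite {x z : A.Face} (h : x ≤ z) : x * -(x * -z) = z := by
  ext1; funext H
  by_cases hx : x.sign H = 0
  · rw [sign_mul_of_eq _ hx, sign_neg, sign_mul_of_eq _ hx, sign_neg, neg_neg]
  · rw [sign_mul_of_ne _ hx]
    exact (h H).resolve_left hx

/-- The incidence number determines the side of `x` on which a face covering `x` lies. -/
theorem eq_of_inc_eq {x z z' : A.Face} (h : x ≤ z) (h' : x ≤ z') (hf : z.flat = z'.flat)
    (hc : x.flat ⋖ z.flat) (hi : inc x z = inc x z') : z = z' := by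
  by_contra hne
  obtain ⟨H, hH⟩ : ∃ H, z.sign H ≠ z'.sign H := by
    by_contra! h; exact hne (Face.ext (funext h))
  have hx : x.sign H = 0 := by
    by_contra h0
    exact hH (((h H).resolve_left h0).symm.trans ((h' H).resolve_left h0))
  have hz : z.sign H ≠ 0 := fun h0 => hH (h0.trans ((flat_eq.1 hf H).1 h0).symm)
  have hz' : z'.sign H ≠ 0 := fun h0 => hz ((flat_eq.1 hf H).2 h0)
  have hs : z.sign H = -z'.sign H := by
    revert hH hz hz'
    generalize z.sign H = a
    generalize z'.sign H = b
    decide +revert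
  have h1 := inc_eq_neg rfl hf hc h h' hx hz hs
  have h2 := inc_ne_zero h hc
  rw [← hi] at h1
  revert h1 h2
  generalize inc x z = a
  decide +revert

/-- Inside a flat covering its own, x has one cover on each side, and xy is the one on the side of
y. -/
theorem eq_mul_of_sign_eq {x z y : A.Face} (h : x ≤ z) (hc : x.flat ⋖ y.flat)
    (hf : z.flat = y.flat) {H : A.hyperplanes} (hx : x.sign H = 0) (hy : y.sign H ≠ 0)
    (hs : z.sign H = y.sign H) : z = x * y := by
  have hf' : z.flat = (x * y).flat := by rw [flat_mul_of_le hc.le, hf]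
  refine eq_of_inc_eq h (le_mul x y) hf' (hf ▸ hc) ?_
  refine inc_eq rfl hf' (hf ▸ hc) h (le_mul x y) hx (hs ▸ hy) ?_
  rw [sign_mul_of_eq _ hx, hs]

theorem mul_eq_of_between {x z z' y : A.Face} (hz : x.flat ⋖ z.flat)
    (hz' : x.flat ⋖ z'.flat) (hzy : z ≤ y) (hzy' : z' ≤ y) (hc : z.flat ⋖ y.flat)
    (hne : z ≠ z') : z * z' = y := by
  have hcomm : z * z' = z' * z := by
    ext1; funext H
    by_cases h : z.sign H = 0
    · rw [sign_mul_of_eq _ h]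
      by_cases h' : z'.sign H = 0
      · rw [sign_mul_of_eq _ h', h, h']
      · rw [sign_mul_of_ne _ h']
    · rw [sign_mul_of_ne _ h]
      by_cases h' : z'.sign H = 0
      · rw [sign_mul_of_eq _ h']
      · rw [sign_mul_of_ne _ h', (hzy H).resolve_left h, (hzy' H).resolve_left h']
  have hle := mul_le hzy hzy'
  refine eq_of_le_of_flat_le hle ?_
  have h1 := le_flat_mul_left z z'
  rcases h1.eq_or_lt with h1 | h1
  · exfalso
    have h2 : z'.flat ≤ z.flat := by rw [h1]; exact le_flat_mul_right z z'
    have h3 : z'.flat = z.flat := h2.eq_of_not_lt fun h => hz.2 hz'.lt h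
    apply hne
    rw [← mul_eq_left h3.le, hcomm, mul_eq_left h3.ge]
  · by_contra h
    exact hc.2 h1 (lt_of_le_not_ge (flat_mono hle) h)

/-- Since zz' = y, a point of z' lies on the same side of z as y does, so it can replace the point
of y when computing the incidence of z in y. The claim becomes the sign rule `form_add`. -/
theorem inc_mul_inc_eq_neg {x z z' y : A.Face} (hxz : x ≤ z) (hxz' : x ≤ z') (hzy : z ≤ y)
    (hzy' : z' ≤ y) (h1 : x.flat ⋖ z.flat) (h2 : x.flat ⋖ z'.flat)
    (h3 : z.flat ⋖ y.flat) (h4 : z'.flat ⋖ y.flat) (hne : z ≠ z') :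
    inc x z * inc z y = -(inc x z' * inc z' y) := by
  have key : ∀ {z z' : A.Face}, x.flat ⋖ z.flat → x.flat ⋖ z'.flat → z ≤ y → z' ≤ y →
      z.flat ⋖ y.flat → z'.flat ⋖ y.flat → z ≠ z' →
      inc z y = SignType.sign (form z y z'.pt) := by
    intro z z' h1 h2 hzy hzy' h3 h4 hne
    obtain ⟨H, hz, hy⟩ := exists_sign_of_flat_lt h3.lt
    have hy' := congrArg (fun f => f.sign H) (mul_eq_of_between h1 h2 hzy hzy' h3 hne)
    simp only [sign_mul_of_eq _ hz] at hy'
    have hm : z'.pt ∈ y.supp := h4.le z'.pt_mem_supp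
    have := congrArg SignType.sign (form_mul_form h3 hz hy y.pt_mem_supp hm)
    rw [_root_.sign_mul, _root_.sign_mul, sign_pt, sign_pt, hy'] at this
    rw [inc_of_covBy hzy h3]
    exact (mul_left_cancel₀ hy this).symm
  rw [key h1 h2 hzy hzy' h3 h4 hne, key h2 h1 hzy' hzy h4 h3 hne.symm, inc_of_covBy hxz h1,
    inc_of_covBy hxz' h2, ← _root_.sign_mul, ← _root_.sign_mul, ← Left.sign_neg,
    eq_neg_of_add_eq_zero_left (form_add h1 h2 h3 h4)]

/-- Moving from a point of y in the direction opposite to z, the first wall reached among the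
hyperplanes containing x but not z yields the other face. -/
theorem exists_other_between {x z y : A.Face} (hxz : x < z) (hzy : z < y) :
    ∃ z', z' ≠ z ∧ x < z' ∧ z' < y := by
  obtain ⟨H₁, hx₁, hz₁⟩ := exists_sign_of_flat_lt (flat_lt_of_lt hxz)
  obtain ⟨H₂, hz₂, hy₂⟩ := exists_sign_of_flat_lt (flat_lt_of_lt hzy)
  let r : A.hyperplanes → ℝ := fun H => A.form H y.pt / A.form H z.pt
  obtain ⟨H₀, ⟨hx₀, hz₀⟩, hmin⟩ := Set.exists_min_image
    {H : A.hyperplanes | x.sign H = 0 ∧ z.sign H ≠ 0} r (Set.toFinite _) ⟨H₁, hx₁, hz₁⟩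
  have hform : ∀ {H}, z.sign H ≠ 0 → A.form H z.pt ≠ 0 := fun {H} h h0 => h (by
    rw [← sign_pt, h0, sign_zero])
  -- The minimal ratio `r H₀` is the time of the first hit: signs on the hyperplanes containing x
  -- can only become zero, never flip.
  let q : A.Face := ofPoint A (y.pt - r H₀ • z.pt)
  have hq : ∀ H, q.sign H = SignType.sign (A.form H y.pt - r H₀ * A.form H z.pt) := fun H => by
    simp [q]
  have hq0 : ∀ H, z.sign H = 0 → q.sign H = y.sign H := fun H h => by
    rw [← sign_pt, sign_eq_zero_iff] at h
    rw [hq, h, mul_zero, sub_zero, sign_pt]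
  have hq₀ : q.sign H₀ = 0 := by
    rw [hq, div_mul_cancel₀ _ (hform hz₀), sub_self, sign_zero]
  have hx₂ : x.sign H₂ = 0 := flat_le.1 (flat_mono hxz.le) H₂ hz₂
  have hle : x * q ≤ y := by
    intro H
    by_cases hx : x.sign H = 0
    · rw [sign_mul_of_eq _ hx]
      by_cases hz : z.sign H = 0
      · exact Or.inr (hq0 H hz)
      · have hzy' : z.sign H = y.sign H := (hzy.le H).resolve_left hz
        have h1 : r H₀ ≤ r H := hmin H ⟨hx, hz⟩
        have h2 : A.form H y.pt - r H₀ * A.form H z.pt = (r H - r H₀) * A.form H z.pt := by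
          rw [sub_mul, div_mul_cancel₀ _ (hform hz)]
        rw [hq, h2, _root_.sign_mul, sign_pt, hzy']
        rcases h1.eq_or_lt with h1 | h1
        · left; rw [h1, sub_self, sign_zero, zero_mul]
        · right; rw [sign_pos (sub_pos.2 h1), one_mul]
    · rw [sign_mul_of_ne _ hx]
      exact (hxz.le.trans hzy.le) H
  refine ⟨x * q, ?_, lt_of_le_of_ne (le_mul x q) ?_, lt_of_le_of_ne hle ?_⟩
  · intro h
    apply hz₀
    rw [← h, sign_mul_of_eq _ hx₀, hq₀]
  · intro h
    apply hy₂
    rw [← hq0 H₂ hz₂, ← sign_mul_of_eq q hx₂, ← h, hx₂]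
  · intro h
    apply hz₀
    apply flat_le.1 (flat_mono hzy.le)
    rw [← h, sign_mul_of_eq _ hx₀, hq₀]

end Face

end CentralArrangement

/-! ### The coboundary complex of the faces -/

namespace CentralArrangement

variable {d : ℕ} {A : CentralArrangement d}

namespace Face

section Complex

variable {k : Type*} [Field k]

variable (k) in
/-- The incidence numbers of the faces, as elements of a field. -/
noncomputable def incCast (x z : A.Face) : k := (inc x z : SignType)

theorem inc_ne_of_incCast_ne {x z : A.Face} (h : incCast k x z ≠ 0) : inc x z ≠ 0 := by
  intro h0
  simp [incCast, h0] at h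

theorem le_of_incCast_ne {x z : A.Face} (h : incCast k x z ≠ 0) : x ≤ z :=
  le_of_inc_ne (inc_ne_of_incCast_ne h)

theorem covBy_of_incCast_ne {x z : A.Face} (h : incCast k x z ≠ 0) : x.flat ⋖ z.flat :=
  covBy_of_inc_ne (inc_ne_of_incCast_ne h)

theorem incCast_ne_zero {x z : A.Face} (h : x ≤ z) (h' : x.flat ⋖ z.flat) :
    incCast k x z ≠ 0 := by
  have := inc_ne_zero h h'
  rw [incCast]
  revert this
  generalize inc x z = a
  intro h
  cases a <;> simp_all

/-- The incidence numbers of `x` cancel over every set of faces closed under passing to the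
opposite side of `x`. -/
theorem sum_incCast_eq_zero (x : A.Face) (p : A.Face → Prop) [DecidablePred p]
    (hp : ∀ w, x ≤ w → x.flat ⋖ w.flat → p w → p (x * -w)) :
    ∑ w, (if p w then incCast k x w else 0) = 0 := by
  classical
  rw [← Finset.sum_filter]
  have hop : ∀ {w}, inc x w ≠ 0 → inc x (x * -w) = -inc x w := fun {w} h =>
    inc_opposite (le_of_inc_ne h) (covBy_of_inc_ne h)
  have hne : ∀ {w}, inc x w ≠ 0 → inc x (x * -w) ≠ 0 := fun {w} h => by
    rw [hop h, Ne, SignType.neg_eq_zero_iff]; exact h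
  -- The fixed points are the faces with zero incidence number, which contribute nothing.
  refine Finset.sum_involution (fun w _ => if inc x w = 0 then w else x * -w) ?_ ?_ ?_ ?_
  · intro w _
    split_ifs with h
    · simp [incCast, h]
    · simp only [incCast, hop h, SignType.coe_neg, add_neg_cancel]
  · intro w _ hw h
    have h0 := inc_ne_of_incCast_ne hw
    rw [if_neg h0] at h
    have := hop h0
    rw [h] at this
    revert this h0
    generalize inc x w = a
    decide +revert
  · intro w hw
    simp only [Finset.mem_filter, Finset.mem_univ, true_and] at hw ⊢
    split_ifs with h
    · exact hw
    · exact hp w (le_of_inc_ne h) (covBy_of_inc_ne h) hw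
  · intro w _
    by_cases h : inc x w = 0
    · simp [h]
    · rw [if_neg h, if_neg (hne h), opposite_opposite (le_of_inc_ne h)]

/-- If any term is nonzero, exactly two are, and they are opposite. A third would give three signs
that are pairwise negatives of each other. -/
theorem sum_incCast_mul_incCast (x y : A.Face) :
    ∑ z, incCast k x z * incCast k z y = 0 := by
  classical
  by_cases h : ∃ z, inc x z ≠ 0 ∧ inc z y ≠ 0
  · obtain ⟨z, h1, h2⟩ := h
    have hxz : x < z := lt_of_le_of_ne (le_of_inc_ne h1) fun h =>
      (covBy_of_inc_ne h1).lt.ne (congrArg flat h)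
    have hzy : z < y := lt_of_le_of_ne (le_of_inc_ne h2) fun h =>
      (covBy_of_inc_ne h2).lt.ne (congrArg flat h)
    obtain ⟨z', hne, hxz', hzy'⟩ := exists_other_between hxz hzy
    have hd := finrank_of_covBy (covBy_of_inc_ne h1)
    have hd' := finrank_of_covBy (covBy_of_inc_ne h2)
    have hl := finrank_lt (flat_lt_of_lt hxz')
    have hl' := finrank_lt (flat_lt_of_lt hzy')
    have h1' : inc x z' ≠ 0 :=
      inc_ne_zero hxz'.le (covBy_of_finrank (flat_lt_of_lt hxz') (by omega))
    have h2' : inc z' y ≠ 0 :=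
      inc_ne_zero hzy'.le (covBy_of_finrank (flat_lt_of_lt hzy') (by omega))
    have hopp : ∀ {u v : A.Face}, inc x u ≠ 0 → inc u y ≠ 0 → inc x v ≠ 0 → inc v y ≠ 0 →
        u ≠ v → inc x u * inc u y = -(inc x v * inc v y) := fun hu hu' hv hv' huv =>
      inc_mul_inc_eq_neg (le_of_inc_ne hu) (le_of_inc_ne hv) (le_of_inc_ne hu') (le_of_inc_ne hv')
        (covBy_of_inc_ne hu) (covBy_of_inc_ne hv) (covBy_of_inc_ne hu') (covBy_of_inc_ne hv') huv
    rw [Fintype.sum_eq_add z z' hne.symm]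
    · simp only [incCast, ← SignType.coe_mul]
      rw [hopp h1 h2 h1' h2' hne.symm, SignType.coe_neg, neg_add_cancel]
    · rintro w ⟨hw, hw'⟩
      by_contra h0
      have hw1 := inc_ne_of_incCast_ne (left_ne_zero_of_mul h0)
      have hw2 := inc_ne_of_incCast_ne (right_ne_zero_of_mul h0)
      have e1 := hopp hw1 hw2 h1 h2 hw
      have e2 := hopp hw1 hw2 h1' h2' hw'
      have e3 := hopp h1 h2 h1' h2' hne.symm
      have e4 := mul_ne_zero h1 h2
      rw [e1, e3] at e2
      rw [e3] at e4
      revert e2 e4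
      generalize inc x z' * inc z' y = a
      decide +revert
  · refine Finset.sum_eq_zero fun z _ => ?_
    by_contra h0
    exact h ⟨z, inc_ne_of_incCast_ne (left_ne_zero_of_mul h0),
      inc_ne_of_incCast_ne (right_ne_zero_of_mul h0)⟩

variable (k A) in
/-- The coboundary of the complex of faces. -/
noncomputable def diff : Module.End k (A.Face → k) where
  toFun p z := ∑ x, p x * incCast k x z
  map_add' p q := by ext z; simp [add_mul, Finset.sum_add_distrib]
  map_smul' c p := by ext z; simp [mul_assoc, Finset.mul_sum]

theorem diff_apply (p : A.Face → k) (z : A.Face) : diff A k p z = ∑ x, p x * incCast k x z := rfl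

theorem diff_congr {p q : A.Face → k} {z : A.Face}
    (h : ∀ x, x ≤ z → x.flat ⋖ z.flat → p x = q x) : diff A k p z = diff A k q z := by
  refine Finset.sum_congr rfl fun x _ => ?_
  by_cases h0 : incCast k x z = 0
  · rw [h0, mul_zero, mul_zero]
  · rw [h x (le_of_incCast_ne h0) (covBy_of_incCast_ne h0)]

theorem diff_eq_zero {p : A.Face → k} {z : A.Face}
    (h : ∀ x, x ≤ z → x.flat ⋖ z.flat → p x = 0) : diff A k p z = 0 := by
  rw [diff_congr (q := 0) h, map_zero, Pi.zero_apply]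

open Classical in
theorem diff_single (x : A.Face) : diff A k (Pi.single x 1) = incCast k x := by
  ext z
  rw [diff_apply, Finset.sum_eq_single x] <;> simp +contextual

theorem diff_diff (p : A.Face → k) : diff A k (diff A k p) = 0 := by
  ext y
  simp only [diff_apply, Finset.sum_mul, Pi.zero_apply]
  rw [Finset.sum_comm]
  refine Finset.sum_eq_zero fun x _ => ?_
  simp only [mul_assoc]
  rw [← Finset.mul_sum, sum_incCast_mul_incCast, mul_zero]

open Classical in
variable (k) in
/-- The sum of the coefficients of the faces of support `Y`. -/
noncomputable def aug (Y : A.IntersectionLattice) : (A.Face → k) →ₗ[k] k where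
  toFun p := ∑ x, if x.flat = Y then p x else 0
  map_add' p q := by
    rw [← Finset.sum_add_distrib]
    exact Finset.sum_congr rfl fun x _ => by split_ifs <;> simp
  map_smul' c p := by
    rw [RingHom.id_apply, smul_eq_mul, Finset.mul_sum]
    exact Finset.sum_congr rfl fun x _ => by split_ifs <;> simp

open Classical in
theorem aug_apply (Y : A.IntersectionLattice) (p : A.Face → k) :
    aug k Y p = ∑ x, if x.flat = Y then p x else 0 := rfl

theorem aug_congr {Y : A.IntersectionLattice} {p q : A.Face → k}
    (h : ∀ x, x.flat = Y → p x = q x) : aug k Y p = aug k Y q := by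
  refine Finset.sum_congr rfl fun x _ => ?_
  split_ifs with hx
  · exact h x hx
  · rfl

theorem aug_eq_zero {Y : A.IntersectionLattice} {p : A.Face → k}
    (h : ∀ x, x.flat = Y → p x = 0) : aug k Y p = 0 := by
  rw [aug_congr (q := 0) h, map_zero]

theorem sum_ite_diff (Q : A.Face → Prop) [DecidablePred Q] (p : A.Face → k) :
    ∑ z, (if Q z then diff A k p z else 0) =
      ∑ x, p x * ∑ z, (if Q z then incCast k x z else 0) := by
  simp only [diff_apply, Finset.mul_sum, mul_ite, mul_zero]
  rw [Finset.sum_comm]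
  refine Finset.sum_congr rfl fun z _ => ?_
  split_ifs <;> simp

theorem aug_diff (Y : A.IntersectionLattice) (p : A.Face → k) : aug k Y (diff A k p) = 0 := by
  classical
  rw [aug_apply, sum_ite_diff fun z => z.flat = Y]
  refine Finset.sum_eq_zero fun x _ => ?_
  rw [sum_incCast_eq_zero, mul_zero]
  rintro w _ hw rfl
  rw [flat_mul_of_le] <;> rw [flat_neg]
  exact hw.le

end Complex

end Face

end CentralArrangement

/-! ### Exactness of the complex of a convex cell -/

namespace CentralArrangement

variable {d : ℕ} {A : CentralArrangement d}

namespace Face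

/-- The face `x` lies in the support of `y`, and on the same side as `y` of the hyperplanes
in `S`. -/
def InCell (S : Finset A.hyperplanes) (y x : A.Face) : Prop :=
  x.flat ≤ y.flat ∧ ∀ H ∈ S, x.sign H = y.sign H

theorem InCell.of_le {S : Finset A.hyperplanes} {y x z : A.Face} (h : InCell S y x) (hxz : x ≤ z)
    (hz : z.flat ≤ y.flat) : InCell S y z := by
  refine ⟨hz, fun H hH => ?_⟩
  rcases hxz H with h0 | h0
  · have := (h.2 H hH).symm.trans h0
    rw [this, flat_le.1 hz H this]
  · rw [← h0, h.2 H hH]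

/-- If H does not have all of the cell strictly on the side of y, convexity gives a point of the
cell on H, and a face near it fills out supp y ∩ H. -/
theorem InCell.exists_wall {S : Finset A.hyperplanes} {y x : A.Face} (h : InCell S y x)
    {H : A.hyperplanes} (hH : x.sign H ≠ y.sign H) :
    ∃ w, InCell S y w ∧ w.sign H = 0 ∧ w.flat ⋖ y.flat := by
  have hy : y.sign H ≠ 0 := fun h0 => hH ((flat_le.1 h.1 H h0).trans h0.symm)
  obtain ⟨f, hf⟩ := y.exists_supp_eq_inf H
  have hfH : f.sign H = 0 := sign_eq_zero_of_supp_le (hf.trans_le inf_le_right)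
  have hle : f.flat ≤ y.flat := show f.supp ≤ y.supp from hf.trans_le inf_le_left
  have hlt : f.flat < y.flat := lt_of_le_not_ge hle fun h => hy (flat_le.1 h H hfH)
  have hc : f.flat ⋖ y.flat := covBy_of_finrank hlt (by rw [finrank_supp_inf hy, hf])
  set a := A.form H y.pt
  set b := A.form H x.pt
  have ha : a ≠ 0 := fun h => hy (by rw [← sign_pt, sign_eq_zero_iff]; exact h)
  have hab : 0 ≤ -(a * b) := by
    by_contra! h'
    apply hH
    have h1 : SignType.sign (a * b) = 1 := sign_pos (by linarith)
    rw [_root_.sign_mul, sign_pt, sign_pt] at h1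
    revert h1
    generalize x.sign H = s
    generalize y.sign H = t
    decide +revert
  -- The combination of the two points on which the form of H vanishes. Its coefficients are
  -- positive and nonnegative, so the signs on `S` survive.
  set u : Fin d → ℝ := (a * a) • x.pt + (-(a * b)) • y.pt
  have hu : ∀ H', A.form H' u = a * a * A.form H' x.pt + -(a * b) * A.form H' y.pt := fun H' => by
    simp [u]
  have huf : u ∈ f.supp := by
    rw [hf]
    refine ⟨add_mem (Submodule.smul_mem _ _ (h.1 x.pt_mem_supp))
      (Submodule.smul_mem _ _ y.pt_mem_supp), ?_⟩
    rw [SetLike.mem_coe, LinearMap.mem_ker, hu]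
    change a * a * b + -(a * b) * a = 0
    ring
  have huf' : (ofPoint A u).flat ≤ f.flat := flat_le.2 fun H' h' => by
    rw [sign_ofPoint, sign_eq_zero_iff]; exact mem_supp.1 huf H' h'
  have hflat : (ofPoint A u * f).flat = f.flat := flat_mul_of_le huf'
  refine ⟨ofPoint A u * f, ⟨hflat.trans_le hle, fun H' hS => ?_⟩, ?_, by rwa [hflat]⟩
  · by_cases h0 : y.sign H' = 0
    · rw [h0]
      exact flat_le.1 (hflat.trans_le hle) H' h0
    · have hs := h.2 H' hS
      have hsu : (ofPoint A u).sign H' = y.sign H' := by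
        rw [sign_ofPoint, hu]
        rcases SignType.trichotomy (y.sign H') with h1 | h1 | h1
        · rw [h1] at hs ⊢
          rw [← sign_pt, sign_eq_neg_one_iff] at hs h1
          rw [sign_eq_neg_one_iff]
          nlinarith [mul_pos_of_neg_of_neg hs hs, mul_self_pos.2 ha,
            mul_nonneg hab (neg_nonneg.2 h1.le), mul_pos (mul_self_pos.2 ha) (neg_pos.2 hs)]
        · exact (h0 h1).elim
        · rw [h1] at hs ⊢
          rw [← sign_pt, sign_eq_one_iff] at hs h1
          rw [sign_eq_one_iff]
          exact add_pos_of_pos_of_nonneg (mul_pos (mul_self_pos.2 ha) hs)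
            (mul_nonneg hab h1.le)
      rw [sign_mul_of_ne _ (hsu ▸ h0), hsu]
  · rw [sign_mul_eq_zero]
    exact ⟨flat_le.1 huf' H hfH, hfH⟩

variable {k : Type*} [Field k]

/-- The complex of the faces in a convex cell is exact below its top degree, and there the
cokernel is detected by the sum of the coefficients. -/
theorem exists_diff_eq (S : Finset A.hyperplanes) :
    ∀ (y : A.Face) (p : A.Face → k), (∀ x, p x ≠ 0 → InCell S y x) →
      (∀ z, z.flat ≤ y.flat → diff A k p z = 0) → aug k y.flat p = 0 →
      ∃ r : A.Face → k, (∀ x, r x ≠ 0 → InCell S y x) ∧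
        ∀ z, z.flat ≤ y.flat → diff A k r z = p z := by
  classical
  -- The induction goes from large `S` to small: when every hyperplane is constrained the cell is
  -- the single face y, and otherwise a further hyperplane cuts the cell into a wall and two halves
  -- or leaves it unchanged.
  induction S using WellFoundedGT.induction with
  | ind S ih =>
  intro y p hp hdp haug
  by_cases hS : ∀ H, H ∈ S
  · have huniq : ∀ x, InCell S y x → x = y := fun x h =>
      Face.ext (funext fun H => h.2 H (hS H))
    have hpy : p = 0 := by
      ext x
      by_contra hx
      have hxy := huniq x (hp x hx)
      subst hxy
      apply hx
      rw [aug_apply, Finset.sum_eq_single x] at haug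
      · simpa using haug
      · intro z _ hz
        split_ifs
        · by_contra h0
          exact hz (huniq z (hp z h0))
        · rfl
      · simp
    exact ⟨0, by simp, by simp [hpy]⟩
  obtain ⟨H, hHS⟩ := not_forall.1 hS
  have hlt : insert H S > S := Finset.ssubset_insert hHS
  by_cases hcut : ∀ x, InCell S y x → x.sign H = y.sign H
  · have hcell : ∀ x, InCell (insert H S) y x ↔ InCell S y x := fun x =>
      ⟨fun h => ⟨h.1, fun H' h' => h.2 H' (Finset.mem_insert_of_mem h')⟩, fun h => ⟨h.1, by
        intro H' h'
        rcases Finset.mem_insert.1 h' with rfl | h'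
        · exact hcut x h
        · exact h.2 H' h'⟩⟩
    have := ih _ hlt y p
    simp only [hcell] at this
    exact this hp hdp haug
  push Not at hcut
  obtain ⟨x, hx, hxH⟩ := hcut
  obtain ⟨w, hw, hwH, hc⟩ := hx.exists_wall hxH
  have hy : y.sign H ≠ 0 := fun h0 => hxH ((flat_le.1 hx.1 H h0).trans h0.symm)
  have hflat_of_sign : ∀ x : A.Face, x.flat ≤ y.flat → x.sign H = 0 → x.flat ≤ w.flat :=
    fun x h h' => flat_le_of_covBy hc hwH hy h h'
  have hsign_of_flat : ∀ x : A.Face, x.flat ≤ w.flat → x.sign H = 0 := fun x h =>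
    flat_le.1 h H hwH
  -- the sums over one side of `H`
  set side : (A.Face → k) → k := fun p =>
    ∑ z, if z.flat = y.flat ∧ z.sign H = y.sign H then p z else 0 with hside
  set ε := incCast k w (w * y) with hε
  have hwy : (w * y).flat = y.flat := flat_mul_of_le hc.le
  have hε0 : ε ≠ 0 := incCast_ne_zero (le_mul w y) (by rwa [hwy])
  -- A face with the support of w has one cover on the side of y, always with incidence ε. Smaller
  -- faces on H have no cover of support supp y, and covers of faces off H cancel in opposite pairs.
  have hside_diff : ∀ q : A.Face → k, (∀ x, q x ≠ 0 → InCell S y x) →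
      side (diff A k q) = ε * aug k w.flat q := by
    intro q hq
    rw [hside]
    dsimp only
    rw [sum_ite_diff, aug_apply, Finset.mul_sum]
    refine Finset.sum_congr rfl fun x _ => ?_
    by_cases hqx : q x = 0
    · simp [hqx]
    have hxy := hq x hqx
    by_cases hxw : x.flat = w.flat
    · have hxH : x.sign H = 0 := hsign_of_flat x hxw.le
      have hxy' : (x * y).flat = y.flat := flat_mul_of_le hxy.1
      rw [if_pos hxw, mul_comm]
      congr 1
      rw [Finset.sum_eq_single (x * y), if_pos ⟨hxy', sign_mul_of_eq _ hxH⟩, hε, incCast, incCast,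
        inc_eq (H := H) hxw (hxy'.trans hwy.symm) (by rwa [hxw, hxy']) (le_mul x y) (le_mul w y)
          hxH (by rwa [sign_mul_of_eq _ hxH])
          (by rw [sign_mul_of_eq _ hxH, sign_mul_of_eq _ hwH])]
      · intro z _ hz
        split_ifs with h
        · by_contra h0
          exact hz (eq_mul_of_sign_eq (le_of_incCast_ne h0) (by rwa [hxw]) h.1 hxH hy h.2)
        · rfl
      · simp
    · rw [if_neg hxw, mul_zero]
      by_cases hxH : x.sign H = 0
      · rw [Finset.sum_eq_zero, mul_zero]
        intro z _
        split_ifs with h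
        · by_contra h0
          have hxz : x.flat ⋖ y.flat := h.1 ▸ covBy_of_incCast_ne h0
          rcases (hflat_of_sign x hxy.1 hxH).eq_or_lt with h1 | h1
          · exact hxw h1
          · exact hxz.2 h1 hc.lt
        · rfl
      · rw [sum_incCast_eq_zero, mul_zero]
        rintro v hv hcv ⟨h1, h2⟩
        constructor
        · rw [flat_mul_of_le, flat_neg, h1]
          rw [flat_neg]; exact hcv.le
        · rw [sign_mul_of_ne _ hxH, (hv H).resolve_left hxH, h2]
  -- the part of `p` on `H`
  have hcell_w : ∀ x, InCell (insert H S) w x ↔ InCell S y x ∧ x.sign H = 0 := by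
    intro x
    constructor
    · intro h
      exact ⟨⟨h.1.trans hc.le, fun H' h' =>
        (h.2 H' (Finset.mem_insert_of_mem h')).trans (hw.2 H' h')⟩, hsign_of_flat x h.1⟩
    · rintro ⟨h, h0⟩
      refine ⟨hflat_of_sign x h.1 h0, fun H' h' => ?_⟩
      rcases Finset.mem_insert.1 h' with rfl | h'
      · rw [h0, hwH]
      · rw [h.2 H' h', hw.2 H' h']
  -- On the wall the restriction of p is again a cocycle; its augmentation vanishes since ε times it
  -- is the one-sided sum of `diff p = 0`.
  obtain ⟨r₀, hr₀, hdr₀⟩ := ih _ hlt w (fun x => if x.sign H = 0 then p x else 0)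
    (by
      intro x hx
      rw [ite_ne_right_iff] at hx
      exact (hcell_w x).2 ⟨hp x hx.2, hx.1⟩)
    (by
      intro z hz
      rw [← hdp z (hz.trans hc.le)]
      refine diff_congr fun x hxz _ => if_pos ?_
      exact flat_le.1 (flat_mono hxz) H (hsign_of_flat z hz))
    (by
      rw [aug_congr (q := p) fun x hx => if_pos (hsign_of_flat x hx.le)]
      refine (mul_eq_zero.1 ((hside_diff p hp).symm.trans ?_)).resolve_left hε0
      refine Finset.sum_eq_zero fun z _ => ?_
      split_ifs with h
      · exact hdp z h.1.le
      · rfl)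
  -- Adding a multiple of w does not change the coboundary on H, where w has top dimension. The
  -- multiple is chosen so that the remainder has sum zero on the side of y; its total sum being
  -- zero, the same holds on the other side.
  set b := ε⁻¹ * side p - aug k w.flat r₀ with hb
  set r₁ : A.Face → k := r₀ + b • Pi.single w 1 with hr₁
  have hr₁cell : ∀ x, r₁ x ≠ 0 → InCell S y x := by
    intro x hx
    by_cases hxw : x = w
    · rw [hxw]; exact hw
    · refine ((hcell_w x).1 (hr₀ x ?_)).1
      simpa [hr₁, hxw] using hx
  have haugw : aug k w.flat (Pi.single w 1 : A.Face → k) = 1 := by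
    rw [aug_apply, Finset.sum_eq_single w] <;> simp +contextual
  have haug₁ : aug k w.flat r₁ = ε⁻¹ * side p := by
    rw [hr₁, map_add, map_smul, haugw, hb]
    simp
  -- the remainder lies off `H`
  set p₂ : A.Face → k := fun z => if z.flat ≤ y.flat then p z - diff A k r₁ z else 0 with hp₂
  have hp₂_of_le : ∀ {z}, z.flat ≤ y.flat → p₂ z = p z - diff A k r₁ z := fun {z} hz => if_pos hz
  have hp₂cell : ∀ x, p₂ x ≠ 0 → InCell S y x := by
    intro z hz
    have hzy : z.flat ≤ y.flat := by
      by_contra h; exact hz (if_neg h)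
    by_contra hcell
    apply hz
    have h1 : p z = 0 := by
      by_contra h; exact hcell (hp z h)
    have h2 : diff A k r₁ z = 0 := diff_eq_zero fun x hxz _ => by
      by_contra h
      exact hcell ((hr₁cell x h).of_le hxz hzy)
    rw [hp₂_of_le hzy, h1, h2, sub_zero]
  have hp₂H : ∀ z, p₂ z ≠ 0 → z.sign H ≠ 0 := by
    intro z hz hzH
    have hzy := (hp₂cell z hz).1
    have hzw := hflat_of_sign z hzy hzH
    apply hz
    have h1 : incCast k w z = 0 := by
      by_contra h
      exact (covBy_of_incCast_ne h).lt.not_ge hzw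
    have h2 := hdr₀ z hzw
    rw [if_pos hzH] at h2
    rw [hp₂_of_le hzy, hr₁, map_add, map_smul, diff_single, Pi.add_apply, h2, Pi.smul_apply, h1,
      smul_zero, add_zero, sub_self]
  have hdp₂ : ∀ z, z.flat ≤ y.flat → diff A k p₂ z = 0 := by
    intro z hz
    rw [diff_congr (q := p - diff A k r₁) fun x hxz _ => hp₂_of_le ((flat_mono hxz).trans hz),
      map_sub, diff_diff, sub_zero, hdp z hz]
  have hside₂ : side p₂ = 0 := by
    have h1 : side p₂ = side p - side (diff A k r₁) := by
      simp only [hside]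
      rw [← Finset.sum_sub_distrib]
      refine Finset.sum_congr rfl fun z _ => ?_
      split_ifs with h
      · exact hp₂_of_le h.1.le
      · rw [sub_zero]
    rw [h1, hside_diff r₁ hr₁cell, haug₁, mul_inv_cancel_left₀ hε0, sub_self]
  have haug₂ : aug k y.flat p₂ = 0 := by
    rw [aug_congr (q := p - diff A k r₁) fun x hx => hp₂_of_le hx.le, map_sub, aug_diff, haug,
      sub_zero]
  -- the two halves of the remainder
  set half : SignType → A.Face → k := fun s x => if x.sign H = s then p₂ x else 0 with hhalf
  have hsplit : p₂ = half (y.sign H) + half (-y.sign H) := by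
    ext x
    simp only [hhalf, Pi.add_apply]
    by_cases hx : p₂ x = 0
    · simp [hx]
    have := hp₂H x hx
    have h3 : (x.sign H = y.sign H ∧ x.sign H ≠ -y.sign H) ∨
        (x.sign H ≠ y.sign H ∧ x.sign H = -y.sign H) := by
      revert this hy
      generalize x.sign H = s
      generalize y.sign H = t
      decide +revert
    rcases h3 with ⟨h, h'⟩ | ⟨h, h'⟩
    · rw [if_pos h, if_neg h', add_zero]
    · rw [if_neg h, if_pos h', zero_add]
  have hhalf_diff : ∀ s, s ≠ 0 → ∀ z, z.flat ≤ y.flat → diff A k (half s) z = 0 := by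
    intro s hs z hz
    by_cases hzs : z.sign H = s
    · rw [← hdp₂ z hz]
      refine diff_congr fun x hxz _ => ?_
      by_cases hx : p₂ x = 0
      · simp [hhalf, hx]
      · exact if_pos (((hxz H).resolve_left (hp₂H x hx)).trans hzs)
    · refine diff_eq_zero fun x hxz _ => if_neg fun hxs => hzs ?_
      rw [← (hxz H).resolve_left (hxs ▸ hs), hxs]
  have haug_half : aug k y.flat (half (y.sign H)) = 0 := by
    rw [← hside₂, aug_apply]
    refine Finset.sum_congr rfl fun x _ => ?_
    simp only [hhalf, ite_and]
  have haug_half' : aug k y.flat (half (-y.sign H)) = 0 := by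
    rwa [hsplit, map_add, haug_half, zero_add] at haug₂
  have hcell_insert : ∀ v : A.Face, v.flat = y.flat → (∀ H' ∈ S, v.sign H' = y.sign H') →
      ∀ x, InCell (insert H S) v x ↔ InCell S y x ∧ x.sign H = v.sign H := by
    intro v hv hvS x
    constructor
    · exact fun h => ⟨⟨h.1.trans hv.le, fun H' h' =>
        (h.2 H' (Finset.mem_insert_of_mem h')).trans (hvS H' h')⟩,
        h.2 H (Finset.mem_insert_self H S)⟩
    · rintro ⟨h, h0⟩
      refine ⟨h.1.trans hv.ge, fun H' h' => ?_⟩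
      rcases Finset.mem_insert.1 h' with rfl | h'
      · exact h0
      · rw [h.2 H' h', hvS H' h']
  have hstep : ∀ v : A.Face, v.flat = y.flat → (∀ H' ∈ S, v.sign H' = y.sign H') →
      v.sign H ≠ 0 → aug k y.flat (half (v.sign H)) = 0 →
      ∃ r : A.Face → k, (∀ x, r x ≠ 0 → InCell S y x) ∧
        ∀ z, z.flat ≤ y.flat → diff A k r z = half (v.sign H) z := by
    intro v hv hvS hvH ha
    obtain ⟨r, hr, hdr⟩ := ih _ hlt v (half (v.sign H))
      (fun x hx => by
        rw [hhalf] at hx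
        dsimp only at hx
        rw [ite_ne_right_iff] at hx
        exact (hcell_insert v hv hvS x).2 ⟨hp₂cell x hx.2, hx.1⟩)
      (fun z hz => hhalf_diff _ hvH z (hz.trans hv.le)) (by rwa [hv])
    exact ⟨r, fun x hx => ((hcell_insert v hv hvS x).1 (hr x hx)).1,
      fun z hz => hdr z (hz.trans hv.ge)⟩
  obtain ⟨r₂, hr₂, hdr₂⟩ := hstep y rfl (fun _ _ => rfl) hy haug_half
  have hvH : (w * -y).sign H = -y.sign H := sign_mul_of_eq _ hwH
  -- The opposite of y across w lies in the other half and keeps the signs on `S`, because w has the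
  -- signs of y there.
  obtain ⟨r₃, hr₃, hdr₃⟩ := hstep (w * -y)
    (by rw [flat_mul_of_le, flat_neg]; rw [flat_neg]; exact hc.le)
    (fun H' h' => by
      by_cases h0 : w.sign H' = 0
      · have := (hw.2 H' h').symm.trans h0
        rw [sign_mul_of_eq _ h0, sign_neg, this]
        rfl
      · rw [sign_mul_of_ne _ h0, hw.2 H' h'])
    (by rw [hvH, Ne, SignType.neg_eq_zero_iff]; exact hy)
    (by rwa [hvH])
  rw [hvH] at hdr₃
  refine ⟨r₁ + r₂ + r₃, fun x hx => ?_, fun z hz => ?_⟩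
  · by_contra hcell
    have h1 : r₁ x = 0 := by by_contra h; exact hcell (hr₁cell x h)
    have h2 : r₂ x = 0 := by by_contra h; exact hcell (hr₂ x h)
    have h3 : r₃ x = 0 := by by_contra h; exact hcell (hr₃ x h)
    simp [h1, h2, h3] at hx
  · have h1 := congrFun hsplit z
    rw [hp₂_of_le hz, Pi.add_apply, ← hdr₂ z hz, ← hdr₃ z hz] at h1
    rw [map_add, map_add, Pi.add_apply, Pi.add_apply, add_assoc, ← h1, add_sub_cancel]

end Face

end CentralArrangement

/-! ### The face algebra as a model over its intersection lattice -/

/-- Transport of a model along an isomorphism of posets. -/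
def PosetModel.reindex {k P Q A M : Type*} [Field k] [PartialOrder P] [Fintype P]
    [PartialOrder Q] [Fintype Q] [Ring A] [Algebra k A] [AddCommGroup M] [Module k M]
    (D : PosetModel k P A M) (f : Q ≃o P) : PosetModel k Q A M where
  action := D.action
  gen := D.gen
  bijective_gen := D.bijective_gen
  proj X := D.proj (f X)
  diff := D.diff
  aug X := D.aug (f X)
  proj_action X := D.proj_action (f X)
  diff_action := D.diff_action
  proj_mul_self X := D.proj_mul_self (f X)
  proj_mul_of_ne X Y h := D.proj_mul_of_ne _ _ (f.injective.ne h)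
  sum_proj := (f.toEquiv.sum_comp D.proj).trans D.sum_proj
  proj_diff_proj X Y h := D.proj_diff_proj _ _ fun h' => h ((apply_covBy_apply_iff f).1 h')
  diff_mul_diff := D.diff_mul_diff
  aug_gen X := D.aug_gen (f X)
  aug_diff Y := D.aug_diff (f Y)
  exists_diff_of_aug Y := D.exists_diff_of_aug (f Y)
  exists_diff_of_diff Y p h := by
    obtain ⟨r, hr⟩ := D.exists_diff_of_diff (f Y) p h
    exact ⟨r, fun Z hZ => hr (f Z) ((apply_covBy_apply_iff f).2 hZ)⟩

namespace CentralArrangement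

variable {d : ℕ} {A : CentralArrangement d}

instance : Finite A.IntersectionLattice := Finite.of_surjective _ Face.flat_surjective

noncomputable instance : Fintype A.IntersectionLattice := Fintype.ofFinite _

namespace Face

variable {k : Type*} [Field k]

open Classical in
theorem hom_ext {M : Type*} [AddCommGroup M] [Module k M] {f g : (A.Face → k) →ₗ[k] M}
    (h : ∀ x, f (Pi.single x 1) = g (Pi.single x 1)) : f = g :=
  LinearMap.pi_ext' fun x => LinearMap.ext_ring (h x)

open Classical in
variable (k) in
/-- The projection to the faces of support `Y`. -/
noncomputable def proj (Y : A.IntersectionLattice) : Module.End k (A.Face → k) where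
  toFun p x := if x.flat = Y then p x else 0
  map_add' p q := by ext x; simp only [Pi.add_apply]; split_ifs <;> simp
  map_smul' c p := by ext x; simp

open Classical in
theorem proj_apply (Y : A.IntersectionLattice) (p : A.Face → k) (x : A.Face) :
    proj k Y p x = if x.flat = Y then p x else 0 := rfl

open Classical in
theorem proj_single (Y : A.IntersectionLattice) (x : A.Face) :
    proj k Y (Pi.single x 1) = if x.flat = Y then Pi.single x 1 else 0 := by
  ext z
  rw [proj_apply]
  by_cases hz : z = x
  · subst hz; split_ifs <;> simp
  · split_ifs <;> simp [hz]

open Classical in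
variable (k) in
/-- The action of a face: multiplication, where it does not change the support. -/
noncomputable def act (y : A.Face) : Module.End k (A.Face → k) where
  toFun p z := ∑ x, if y.flat ≤ x.flat ∧ y * x = z then p x else 0
  map_add' p q := by
    ext z
    rw [Pi.add_apply, ← Finset.sum_add_distrib]
    exact Finset.sum_congr rfl fun x _ => by split_ifs <;> simp
  map_smul' c p := by ext z; simp [Finset.mul_sum]

open Classical in
theorem act_apply (y : A.Face) (p : A.Face → k) (z : A.Face) :
    act k y p z = ∑ x, if y.flat ≤ x.flat ∧ y * x = z then p x else 0 := rfl

open Classical in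
theorem act_single (y x : A.Face) :
    act k y (Pi.single x 1) = if y.flat ≤ x.flat then Pi.single (y * x) 1 else 0 := by
  ext z
  rw [act_apply, Finset.sum_eq_single x]
  · by_cases h : y.flat ≤ x.flat <;> by_cases hz : y * x = z
    · subst hz; simp [h]
    · simp [h, hz, Ne.symm hz]
    · simp [h]
    · simp [h]
  · intro w _ hw
    simp [hw]
  · simp

variable (k A) in
/-- The representation of the face semigroup. -/
noncomputable def actHom : A.Face →* Module.End k (A.Face → k) where
  toFun := act k
  map_one' := by
    classical
    refine hom_ext fun x => ?_
    rw [act_single, if_pos (flat_le.2 fun _ _ => rfl), one_mul]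
    rfl
  map_mul' y y' := by
    classical
    refine hom_ext fun x => ?_
    rw [Module.End.mul_apply, act_single, act_single]
    by_cases h' : y'.flat ≤ x.flat
    · rw [if_pos h', act_single, flat_mul_of_le h', mul_assoc]
      simp only [flat_mul_le, h', and_true]
    · rw [if_neg h', if_neg fun h => h' (flat_mul_le.1 h).2, map_zero]

theorem proj_mul_act (Y : A.IntersectionLattice) (y : A.Face) :
    proj k Y * act k y = act k y * proj k Y := by
  classical
  refine hom_ext fun x => ?_
  rw [Module.End.mul_apply, Module.End.mul_apply, act_single, proj_single]
  by_cases h : y.flat ≤ x.flat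
  · rw [if_pos h, proj_single, flat_mul_of_le h]
    split_ifs with hx
    · rw [act_single, if_pos h]
    · rw [map_zero]
  · rw [if_neg h, map_zero]
    split_ifs with hx
    · rw [act_single, if_neg h]
    · rw [map_zero]

/-- If supp y ≤ supp x, then z ↦ xz and w ↦ yw match the covers of yx with those of x and preserve
incidence. Otherwise y kills x, and the covers of x not killed by y cancel in pairs: opposite covers
w and x(−w) have the same product with y, since a hyperplane containing x and y but not w would
force supp y ≤ supp x. -/
theorem diff_mul_act (y : A.Face) : diff A k * act k y = act k y * diff A k := by
  classical
  refine hom_ext fun x => ?_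
  rw [Module.End.mul_apply, Module.End.mul_apply, act_single, diff_single]
  ext z
  rw [act_apply]
  by_cases h : y.flat ≤ x.flat
  · rw [if_pos h, diff_single, Finset.sum_eq_single (x * z)]
    · have hyx := flat_mul_of_le h
      by_cases hz : y * x ≤ z
      · have hxz : (x * z).flat = z.flat := flat_mul_of_le (hyx ▸ flat_mono hz)
        rw [if_pos ⟨h.trans (le_flat_mul_left x z), by rw [← mul_assoc, mul_eq_of_le hz]⟩]
        by_cases hc : x.flat ⋖ z.flat
        · obtain ⟨H, hx, hzH⟩ := exists_sign_of_flat_lt hc.lt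
          rw [incCast, incCast, inc_eq (H := H) hyx hxz.symm (by rwa [hyx]) hz (le_mul x z)
            ((flat_eq.1 hyx H).2 hx) hzH (sign_mul_of_eq _ hx).symm]
        · have h1 : incCast k (y * x) z = 0 := by
            by_contra h0
            exact hc (hyx ▸ covBy_of_incCast_ne h0)
          have h2 : incCast k x (x * z) = 0 := by
            by_contra h0
            exact hc (hxz ▸ covBy_of_incCast_ne h0)
          rw [h1, h2]
      · rw [if_neg]
        · by_contra h0
          exact hz (le_of_incCast_ne h0)
        · rintro ⟨_, h'⟩
          apply hz
          rw [← h', ← mul_assoc]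
          exact le_mul _ _
    · intro w _ hw
      split_ifs with hw'
      · by_contra h0
        apply hw
        rw [← hw'.2, ← mul_assoc, mul_eq_left h, mul_eq_of_le (le_of_incCast_ne h0)]
      · rfl
    · simp
  · rw [if_neg h, map_zero, Pi.zero_apply, sum_incCast_eq_zero]
    rintro w hxw hc ⟨hyw, rfl⟩
    have hflat : (x * -w).flat = w.flat := by
      rw [flat_mul_of_le, flat_neg]
      rw [flat_neg]; exact hc.le
    refine ⟨hyw.trans_eq hflat.symm, Face.ext (funext fun H => ?_)⟩
    by_cases hy : y.sign H = 0
    · rw [sign_mul_of_eq _ hy, sign_mul_of_eq _ hy]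
      by_cases hx : x.sign H = 0
      · have hw : w.sign H = 0 := by
          by_contra hw
          exact h (flat_le_of_covBy hc hx hw hyw hy)
        rw [sign_mul_of_eq _ hx, sign_neg, hw]
        rfl
      · rw [sign_mul_of_ne _ hx, (hxw H).resolve_left hx]
    · rw [sign_mul_of_ne _ hy, sign_mul_of_ne _ hy]

/-- A face with a given support. -/
noncomputable def rep (X : A.IntersectionLattice) : A.Face :=
  (flat_surjective X).choose

@[simp]
theorem flat_rep (X : A.IntersectionLattice) : (rep X).flat = X := (flat_surjective X).choose_spec

open Classical in
variable (k A) in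
/-- The sum of the chosen faces, one for every support. -/
noncomputable def gen : A.Face → k := ∑ X : A.IntersectionLattice, Pi.single (rep X) 1

open Classical in
theorem proj_gen (X : A.IntersectionLattice) :
    proj k X (gen A k) = Pi.single (rep X) 1 := by
  rw [gen, map_sum, Finset.sum_eq_single X]
  · rw [proj_single, flat_rep, if_pos rfl]
  · intro Y _ hY
    rw [proj_single, flat_rep, if_neg hY]
  · simp

theorem aug_proj (Y : A.IntersectionLattice) (p : A.Face → k) :
    aug k Y (proj k Y p) = aug k Y p :=
  aug_congr fun _ hx => if_pos hx

open Classical in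
theorem aug_single {x : A.Face} {Y : A.IntersectionLattice} (h : x.flat = Y) :
    aug k Y (Pi.single x 1) = 1 := by
  subst h
  rw [aug_apply, Finset.sum_eq_single x] <;> simp +contextual

/-- Triangularity: y·gen is y plus faces of strictly larger support, so induction from the top flat
isolates y. -/
theorem mem_of_act_gen_mem (N : Submodule k (A.Face → k)) (hN : ∀ y, act k y (gen A k) ∈ N)
    [DecidableEq A.Face] : ∀ (X : A.IntersectionLattice) (y : A.Face), y.flat = X →
      Pi.single y (1 : k) ∈ N := by
  intro X
  induction X using WellFoundedGT.induction with
  | ind X ih =>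
  rintro y rfl
  classical
  have h := hN y
  rw [gen, map_sum, ← Finset.add_sum_erase _ _ (Finset.mem_univ y.flat), act_single, flat_rep,
    if_pos le_rfl, mul_eq_left (flat_rep _).le] at h
  convert (N.add_mem_iff_left (sum_mem fun Z hZ => ?_)).1 h
  rw [act_single, flat_rep]
  split_ifs with hle
  · convert ih Z (lt_of_le_of_ne hle (Finset.ne_of_mem_erase hZ).symm) (y * rep Z) ?_
    rw [flat_mul_of_le] <;> rw [flat_rep]
    exact hle
  · exact zero_mem _

variable (A k) in
/-- The face algebra, as a module over itself, is the direct sum of the spaces spanned by the faces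
of a given support. -/
noncomputable def posetModel :
    PosetModel k A.IntersectionLattice (A.FaceAlgebra k) (A.Face → k) where
  action := MonoidAlgebra.lift k _ _ (actHom A k)
  gen := gen A k
  bijective_gen := by
    classical
    let f : A.FaceAlgebra k →ₗ[k] (A.Face → k) :=
      (LinearMap.applyₗ (gen A k)).comp (MonoidAlgebra.lift k _ _ (actHom A k)).toLinearMap
    have hf : ∀ y, f (MonoidAlgebra.single y 1) = act k y (gen A k) := fun y => by
      simp [f, actHom]
    have hs : Function.Surjective f := by
      intro p
      rw [← LinearMap.mem_range, pi_eq_sum_univ p]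
      refine sum_mem fun x _ => Submodule.smul_mem _ _ ?_
      convert mem_of_act_gen_mem (LinearMap.range f) (fun y => ⟨_, hf y⟩) _ x rfl using 1
      ext z
      simp [Pi.single_apply, eq_comm]
    have e := MonoidAlgebra.coeffLinearEquiv k (S := k) (M := A.Face)
    have : FiniteDimensional k (A.FaceAlgebra k) := Module.Finite.equiv e.symm
    have hd : Module.finrank k (A.FaceAlgebra k) = Module.finrank k (A.Face → k) := by
      rw [e.finrank_eq]; simp
    exact ⟨(LinearMap.injective_iff_surjective_of_finrank_eq_finrank hd).2 hs, hs⟩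
  proj := proj k
  diff := diff A k
  aug := aug k
  proj_action X a := by
    induction a using MonoidAlgebra.induction_on with
    | of y => simpa [actHom] using proj_mul_act X y
    | add a b ha hb => rw [map_add, mul_add, add_mul, ha, hb]
    | smul c a ha => rw [map_smul, mul_smul_comm, smul_mul_assoc, ha]
  diff_action a := by
    induction a using MonoidAlgebra.induction_on with
    | of y => simpa [actHom] using diff_mul_act y
    | add a b ha hb => rw [map_add, mul_add, add_mul, ha, hb]
    | smul c a ha => rw [map_smul, mul_smul_comm, smul_mul_assoc, ha]
  proj_mul_self X := by
    ext p x
    simp only [Module.End.mul_apply, proj_apply]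
    split_ifs <;> rfl
  proj_mul_of_ne X Y h := by
    refine LinearMap.ext fun p => funext fun x => ?_
    simp only [Module.End.mul_apply, proj_apply, LinearMap.zero_apply, Pi.zero_apply]
    split_ifs with h1 h2
    · exact (h (h1.symm.trans h2)).elim
    · rfl
    · rfl
  sum_proj := by
    refine LinearMap.ext fun p => funext fun x => ?_
    simp [proj_apply]
  proj_diff_proj X Y h := by
    refine LinearMap.ext fun p => funext fun z => ?_
    simp only [Module.End.mul_apply, LinearMap.zero_apply, Pi.zero_apply]
    rw [proj_apply]
    split_ifs with hz
    · refine diff_eq_zero fun x _ hc => if_neg ?_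
      rintro rfl
      exact h (hz ▸ hc)
    · rfl
  diff_mul_diff := LinearMap.ext diff_diff
  aug_gen X := by
    rw [proj_gen, aug_single (flat_rep X)]
  aug_diff Y p := by rw [aug_proj, Face.aug_diff]
  exists_diff_of_aug Y p h := by
    obtain ⟨y, rfl⟩ := flat_surjective Y
    have hp : ∀ x, proj k y.flat p x ≠ 0 → x.flat = y.flat := fun x hx => by
      by_contra h; exact hx (if_neg h)
    -- With no sign constraints the cell is the whole flat, and a top-degree cochain is
    -- automatically a cocycle there.
    obtain ⟨r, -, hr⟩ := exists_diff_eq ∅ y (proj k y.flat p)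
      (fun x hx => ⟨(hp x hx).le, by simp⟩)
      (fun z hz => diff_eq_zero fun x _ hc => if_neg fun hx => hc.lt.not_ge (hz.trans hx.ge)) h
    refine ⟨r, funext fun x => ?_⟩
    rw [proj_apply, proj_apply]
    split_ifs with hx
    · rw [hr x hx.le, proj_apply, if_pos hx]
    · rfl
  exists_diff_of_diff Y p h := by
    classical
    obtain ⟨y, rfl⟩ := flat_surjective Y
    -- Only the part of p one degree below the top enters the hypothesis; it has no top-degree
    -- coefficients, so its augmentation vanishes trivially.
    obtain ⟨r, -, hr⟩ := exists_diff_eq ∅ y (fun x => if x.flat ⋖ y.flat then p x else 0)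
      (fun x hx => ⟨(ite_ne_right_iff.1 hx).1.le, by simp⟩)
      (fun z hz => by
        by_cases hzy : z.flat = y.flat
        · have := congrFun h z
          rw [proj_apply, if_pos hzy] at this
          exact (diff_congr fun x _ hc => if_pos (hzy ▸ hc)).trans this
        · exact diff_eq_zero fun x _ hc => if_neg fun hx =>
            hx.2 hc.lt (lt_of_le_of_ne hz hzy))
      (aug_eq_zero fun x hx => if_neg fun hc => hc.lt.ne hx)
    refine ⟨r, fun Z hZ => funext fun x => ?_⟩
    rw [proj_apply, proj_apply]
    split_ifs with hx
    · subst hx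
      rw [hr x hZ.le, if_pos hZ]
    · rfl

end Face

/-- The face algebra depends only on the intersection lattice. -/
theorem nonempty_faceAlgebra_algEquiv (k : Type*) [Field k] {d' : ℕ} (A : CentralArrangement d)
    (A' : CentralArrangement d') (f : A.IntersectionLattice ≃o A'.IntersectionLattice) :
    Nonempty (A.FaceAlgebra k ≃ₐ[k] A'.FaceAlgebra k) := by
  obtain ⟨e⟩ := (Face.posetModel A k).nonempty_algEquiv
  obtain ⟨e'⟩ := ((Face.posetModel A' k).reindex f).nonempty_algEquiv
  exact ⟨e.symm.trans e'⟩

end CentralArrangement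

theorem mainTheorem7 {k : Type*} [Field k] {d d' : ℕ}
    (A : CentralArrangement d) (A' : CentralArrangement d') :
    (Nonempty (A.IntersectionLattice ≃o A'.IntersectionLattice) →
      Nonempty (A.FaceAlgebra k ≃ₐ[k] A'.FaceAlgebra k)) ∧
    (Nonempty (A.IntersectionLattice ≃o A'.IntersectionLattice) →
      IsEmpty (A.Face ≃o A'.Face) →
      Nonempty (A.FaceAlgebra k ≃ₐ[k] A'.FaceAlgebra k)) :=
  ⟨fun ⟨f⟩ => CentralArrangement.nonempty_faceAlgebra_algEquiv k A A' f,
    fun ⟨f⟩ _ => CentralArrangement.nonempty_faceAlgebra_algEquiv k A A' f⟩
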